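/- Let $(M,g)$ be a smooth, connected, geodesically complete Riemannian manifold without boundary of dimension $m\ge 1$, with Riemannian distance $d$, and let $x\in M$. For $y\in M$, $l\in\mathbb R$ and $\epsilon>0$ say that all geodesics from $y$ in time $l$ focus within $\epsilon$ from $x$ if $d(\gamma(l),x)<\epsilon$ for every unit speed geodesic $\gamma:\mathbb R\to M$ with $\gamma(0)=y$. Suppose that $(M,g)$ is a $\widetilde Y^x$-manifold, i.e. there is $\overline\epsilon>0$ such that for every $\epsilon$ with $0<\epsilon<\overline\epsilon$ there are $l>\epsilon$ and $y\in M$ such that all geodesics from $y$ in time $l$ focus within $\epsilon$ from $x$. Let $\epsilon_n>0$ be a sequence with $\epsilon_n\to 0$, and let $y_n\in M$ and $l_n>\epsilon_n$ be sequences such that, for every $n$, all geodesics from $y_n$ in time $l_n$ focus within $\epsilon_n$ from $x$. If a subsequence $(y_{n_k},l_{n_k})$ converges in $M\times\mathbb R$ to a point $(\widetilde y,\widetilde l)$, then $\widetilde l\ne 0$ and $(M,g)$ is a $Y^x_{2\widetilde l}$-manifold: every geodesic $\gamma:\mathbb R\to M$ with $\gamma(0)=x$ and $|\dot\gamma(0)|=1$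 satisfies $\gamma(2\widetilde l)=x$. -/

import Mathlib

open Filter Topology Bundle
open scoped Manifold ContDiff

noncomputable section

/-- The velocity `γ'(t) ∈ T_{γ t} M` of a curve `γ : ℝ → M`. -/
def velocity (m : ℕ) {M : Type*} [TopologicalSpace M]
    [ChartedSpace (EuclideanSpace ℝ (Fin m)) M] (γ : ℝ → M) (t : ℝ) :
    TangentSpace (𝓡 m) (γ t) :=
  mfderiv 𝓘(ℝ, ℝ) (𝓡 m) γ t (1 : ℝ)

/-- The expression of the Riemannian metric in the preferred chart `φ` at `p`: for a point `u` in
the image of the chart and `a b ∈ ℝ^m` this is `g (dφ⁻¹_u a) (dφ⁻¹_u b)`, so that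
`chartMetric m p u e_i e_j = g_{ij}(u)`. -/
def chartMetric (m : ℕ) {M : Type*} [TopologicalSpace M]
    [ChartedSpace (EuclideanSpace ℝ (Fin m)) M]
    [RiemannianBundle (fun x : M => TangentSpace (𝓡 m) x)]
    (p : M) (u a b : EuclideanSpace ℝ (Fin m)) : ℝ :=
  inner ℝ
    (mfderiv (𝓡 m) (𝓡 m) (extChartAt (𝓡 m) p).symm u a)
    (mfderiv (𝓡 m) (𝓡 m) (extChartAt (𝓡 m) p).symm u b)

/-- The Christoffel symbols of the first kind of the Levi-Civita connection in the preferred chart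
at `p`: `Γ_u(a, b; w) = (∂_a g(b, w) + ∂_b g(a, w) - ∂_w g(a, b)) / 2` at the point `u`. -/
def chartChristoffel (m : ℕ) {M : Type*} [TopologicalSpace M]
    [ChartedSpace (EuclideanSpace ℝ (Fin m)) M]
    [RiemannianBundle (fun x : M => TangentSpace (𝓡 m) x)]
    (p : M) (u a b w : EuclideanSpace ℝ (Fin m)) : ℝ :=
  (fderiv ℝ (fun z => chartMetric m p z b w) u a
    + fderiv ℝ (fun z => chartMetric m p z a w) u b
    - fderiv ℝ (fun z => chartMetric m p z a b) u w) / 2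

/-- `γ : ℝ → M` is a geodesic: it is smooth and in every preferred chart of `M`, wherever the curve
is in the domain of that chart, its coordinate expression `c` satisfies the geodesic equation
`∇_{c'} c' = 0`. The equation is written with its index lowered, that is, paired by the metric with
every `w`: `g_c(c'', w) + Γ_c(c', c'; w) = 0`. -/
def IsGeodesic (m : ℕ) {M : Type*} [TopologicalSpace M]
    [ChartedSpace (EuclideanSpace ℝ (Fin m)) M]
    [RiemannianBundle (fun x : M => TangentSpace (𝓡 m) x)] (γ : ℝ → M) : Prop :=
  ContMDiff 𝓘(ℝ, ℝ) (𝓡 m) ∞ γ ∧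
    ∀ (p : M) (t : ℝ), γ t ∈ (chartAt (EuclideanSpace ℝ (Fin m)) p).source →
      let c : ℝ → EuclideanSpace ℝ (Fin m) := fun s => extChartAt (𝓡 m) p (γ s)
      ∀ w : EuclideanSpace ℝ (Fin m),
        chartMetric m p (c t) (deriv (deriv c) t) w
          + chartChristoffel m p (c t) (deriv c t) (deriv c t) w = 0

/-- Geodesic completeness: every tangent vector is the initial velocity of a geodesic defined on
all of `ℝ`. -/
def IsGeodesicallyComplete (m : ℕ) (M : Type*) [TopologicalSpace M]
    [ChartedSpace (EuclideanSpace ℝ (Fin m)) M]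
    [RiemannianBundle (fun x : M => TangentSpace (𝓡 m) x)] : Prop :=
  ∀ v : TangentBundle (𝓡 m) M, ∃ γ : ℝ → M, IsGeodesic m γ ∧
    (⟨γ 0, velocity m γ 0⟩ : TangentBundle (𝓡 m) M) = v

/-- `M` is a `Y^x_l`-manifold: `l ≠ 0` and every geodesic `γ` with `γ(0) = x` and `|γ'(0)| = 1`
satisfies `γ(l) = x`. -/
def IsYlManifold (m : ℕ) {M : Type*} [TopologicalSpace M]
    [ChartedSpace (EuclideanSpace ℝ (Fin m)) M]
    [RiemannianBundle (fun x : M => TangentSpace (𝓡 m) x)] (x : M) (l : ℝ) : Prop :=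
  l ≠ 0 ∧ ∀ γ : ℝ → M, IsGeodesic m γ → γ 0 = x → ‖velocity m γ 0‖ = 1 → γ l = x

/-- All (unit speed) geodesics from `y` in time `l` focus within `ε` from `x`. -/
def FocusesWithin (m : ℕ) {M : Type*} [MetricSpace M]
    [ChartedSpace (EuclideanSpace ℝ (Fin m)) M]
    [RiemannianBundle (fun x : M => TangentSpace (𝓡 m) x)] (y : M) (l ε : ℝ) (x : M) : Prop :=
  ∀ γ : ℝ → M, IsGeodesic m γ → (∀ t, ‖velocity m γ t‖ = 1) → γ 0 = y → dist (γ l) x < ε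

/-- `M` is a `Ỹ^x`-manifold: for all sufficiently small `ε > 0` there are `l > ε` and a point `y`
such that all geodesics from `y` in time `l` focus within `ε` from `x`. -/
def IsYTildeManifold (m : ℕ) {M : Type*} [MetricSpace M]
    [ChartedSpace (EuclideanSpace ℝ (Fin m)) M]
    [RiemannianBundle (fun x : M => TangentSpace (𝓡 m) x)] (x : M) : Prop :=
  ∃ εbar : ℝ, 0 < εbar ∧ ∀ ε : ℝ, 0 < ε → ε < εbar →
    ∃ l : ℝ, ε < l ∧ ∃ y : M, FocusesWithin m y l ε x

end

/-! The limit time is nonzero because short geodesics minimise. For a unit speed geodesic `γ` from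
`y n`, focusing applies to `γ` and to its reversal, so `γ (l n)` and `γ (-l n)` both lie within `ε
n` of `x` and are less than `2 * ε n` apart. If `l n` tended to zero, local minimality near `x`
(`exists_forall_le_dist_of_isUnitGeodesic`) would put them at least `2 * l n > 2 * ε n` apart.
Minimality itself comes from a calibration argument in a chart (`geodesic_length_le`), with neither
exponential map nor Gauss lemma.

Continuous dependence on initial data (`PhaseTendsto.all_times`) makes the focusing exact in the
limit: every unit speed geodesic from `ylim` is at `x` at time `llim` (`FocusesWithin.lim_eq`).

Sending an initial direction at `ylim` to the arrival velocity at time `llim` is then a map from the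
unit sphere at `ylim` to the unit sphere at `x`. It is differentiable along the flow
(`PhaseStrictDiff.all_times`), and its differential is injective because Grönwall backwards in time
bounds the initial direction by the arrival velocity. Its image is therefore open and compact, hence
everything if `m ≥ 2`, where spheres are connected. If `m = 1` each sphere has two points and
injectivity suffices. So every unit speed geodesic from `x` is the continuation of one from `ylim`
and is at `ylim` at time `-llim` (`IsUnitGeodesic.apply_neg_eq_of_forall`). Applied to the reversed
geodesic this gives `γ llim = ylim`, and the geodesic restarted there is back at `x` after another
`llim`. -/

section

open Set

set_option maxSynthPendingDepth 3

/-! ### The metric in a chart, as a smooth positive definite form. -/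

noncomputable section ChartCalculus

variable {m : ℕ} {M : Type*} [TopologicalSpace M] [ChartedSpace (EuclideanSpace ℝ (Fin m)) M]

local notation "𝔼" => EuclideanSpace ℝ (Fin m)

section Smooth

variable [IsManifold (𝓡 m) ∞ M]

lemma mdifferentiableAt_extChartAt_symm (p : M) {u : 𝔼} (hu : u ∈ (extChartAt (𝓡 m) p).target) :
    MDifferentiableAt (𝓡 m) (𝓡 m) (extChartAt (𝓡 m) p).symm u :=
  ((contMDiffOn_extChartAt_symm (I := 𝓡 m) (n := ∞) p).contMDiffAt
    ((isOpen_extChartAt_target (I := 𝓡 m) p).mem_nhds hu)).mdifferentiableAt (by simp)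

lemma contMDiffOn_mfderiv_extChartAt_symm (p : M) (a : 𝔼) :
    ContMDiffOn (𝓡 m) (𝓡 m).tangent ∞
      (fun u : 𝔼 => (⟨(extChartAt (𝓡 m) p).symm u,
        mfderiv (𝓡 m) (𝓡 m) (extChartAt (𝓡 m) p).symm u a⟩ : TangentBundle (𝓡 m) M))
      (extChartAt (𝓡 m) p).target := by
  have hopen := isOpen_extChartAt_target (I := 𝓡 m) p
  have h := (contMDiffOn_extChartAt_symm (I := 𝓡 m) (n := ∞) p).contMDiffOn_tangentMapWithin
    (m := ∞) (by simp) hopen.uniqueMDiffOn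
  have h2 : ContMDiffOn (𝓡 m) (𝓡 m).tangent ∞
      (fun u : 𝔼 => (⟨u, a⟩ : TangentBundle (𝓡 m) 𝔼)) (extChartAt (𝓡 m) p).target := by
    intro u _
    apply ContMDiffAt.contMDiffWithinAt
    refine (contMDiffAt_totalSpace (F := 𝔼) (E := TangentSpace (𝓡 m)) (IB := 𝓡 m)).2
      ⟨contMDiffAt_id, ?_⟩
    have hc : (fun x : 𝔼 => (trivializationAt 𝔼 (TangentSpace (𝓡 m)) u
        (⟨x, a⟩ : TangentBundle (𝓡 m) 𝔼)).2) = fun _ => a := by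
      funext x
      exact congrArg Prod.snd (trivializationAt_model_space_apply (I := 𝓡 m)
        (⟨x, a⟩ : TangentBundle (𝓡 m) 𝔼) u)
    exact hc ▸ contMDiffAt_const
  have h3 := h.comp h2 (fun u hu => hu)
  refine h3.congr (fun u hu => ?_)
  simp only [Function.comp, tangentMapWithin]
  rw [mfderivWithin_of_isOpen hopen hu]

/-- The differential of the chart is a left inverse. -/
lemma injective_mfderiv_extChartAt_symm (p : M) {u : 𝔼} (hu : u ∈ (extChartAt (𝓡 m) p).target) :
    Function.Injective (mfderiv (𝓡 m) (𝓡 m) (extChartAt (𝓡 m) p).symm u) := by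
  have h := mfderiv_extChartAt_comp_mfderivWithin_extChartAt_symm (I := 𝓡 m) (x := p) hu
  simp only [ModelWithCorners.range_eq_univ, mfderivWithin_univ] at h
  intro a b hab
  have ha := congrArg (fun L => L a) h
  have hb := congrArg (fun L => L b) h
  simp only [ContinuousLinearMap.comp_apply, hab] at ha hb
  exact ha.symm.trans hb

variable [RiemannianBundle (fun x : M => TangentSpace (𝓡 m) x)]
  [IsContMDiffRiemannianBundle (𝓡 m) ∞ (EuclideanSpace ℝ (Fin m))
      (fun x : M => TangentSpace (𝓡 m) x)]

lemma contDiffOn_chartMetric (p : M) (a b : 𝔼) :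
    ContDiffOn ℝ ∞ (fun u => chartMetric m p u a b) (extChartAt (𝓡 m) p).target := by
  rw [← contMDiffOn_iff_contDiffOn]
  exact ContMDiffOn.inner_bundle (F := 𝔼) (contMDiffOn_mfderiv_extChartAt_symm p a)
    (contMDiffOn_mfderiv_extChartAt_symm p b)

end Smooth

section Form

variable [RiemannianBundle (fun x : M => TangentSpace (𝓡 m) x)]

/-- The coordinate metric as a continuous bilinear form. -/
def metricForm (p : M) (u : 𝔼) : 𝔼 →L[ℝ] 𝔼 →L[ℝ] ℝ :=
  (LinearMap.mk₂ ℝ (chartMetric m p u)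
    (fun _ _ _ => (congrArg (fun z => inner ℝ z _) (ContinuousLinearMap.map_add _ _ _)).trans
      (inner_add_left _ _ _))
    (fun _ _ _ => (congrArg (fun z => inner ℝ z _) (ContinuousLinearMap.map_smul _ _ _)).trans
      (real_inner_smul_left _ _ _))
    (fun _ _ _ => (congrArg (fun z => inner ℝ _ z) (ContinuousLinearMap.map_add _ _ _)).trans
      (inner_add_right _ _ _))
    (fun _ _ _ => (congrArg (fun z => inner ℝ _ z) (ContinuousLinearMap.map_smul _ _ _)).trans
      (real_inner_smul_right _ _ _))).toContinuousBilinearMap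

@[simp] lemma metricForm_apply (p : M) (u a b : 𝔼) :
    metricForm p u a b = chartMetric m p u a b := rfl

lemma metricForm_symm (p : M) (u a b : 𝔼) : metricForm p u a b = metricForm p u b a := by
  simp only [metricForm_apply, chartMetric]
  exact real_inner_comm _ _

variable [IsManifold (𝓡 m) ∞ M]

lemma metricForm_pos (p : M) {u : 𝔼} (hu : u ∈ (extChartAt (𝓡 m) p).target) {a : 𝔼} (ha : a ≠ 0) :
    0 < metricForm p u a a := by
  have hne : mfderiv (𝓡 m) (𝓡 m) (extChartAt (𝓡 m) p).symm u a ≠ 0 := by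
    intro h0
    exact ha (injective_mfderiv_extChartAt_symm p hu (h0.trans (map_zero _).symm))
  simp only [metricForm_apply, chartMetric]
  exact real_inner_self_pos.2 hne

variable [IsContMDiffRiemannianBundle (𝓡 m) ∞ (EuclideanSpace ℝ (Fin m))
      (fun x : M => TangentSpace (𝓡 m) x)]

lemma contDiffOn_metricForm (p : M) :
    ContDiffOn ℝ ∞ (metricForm (m := m) p) (extChartAt (𝓡 m) p).target := by
  rw [contDiffOn_clm_apply]
  intro a
  rw [contDiffOn_clm_apply]
  intro b
  exact contDiffOn_chartMetric p a b

end Form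

end ChartCalculus

/-! ### Geodesics of a coordinate metric as a first order ODE. -/

noncomputable section CoordinateMetric

variable {E : Type*} [NormedAddCommGroup E] [NormedSpace ℝ E]

/-- The symbol `w ↦ Γ_u(a, a; w)` of a coordinate metric `g`, as a linear form. -/
def christoffelForm (g : E → E →L[ℝ] E →L[ℝ] ℝ) (u a : E) : E →L[ℝ] ℝ :=
  fderiv ℝ g u a a - (1 / 2 : ℝ) • ((fderiv ℝ g u).flip a).flip a

lemma christoffelForm_apply (g : E → E →L[ℝ] E →L[ℝ] ℝ) (u a w : E) : christoffelForm g u a w =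
    fderiv ℝ g u a a w - 1 / 2 * fderiv ℝ g u w a a := by
  simp [christoffelForm]

/-- The geodesic vector field of a coordinate metric `g` on phase space. -/
def geodesicField (g : E → E →L[ℝ] E →L[ℝ] ℝ) (z : E × E) : E × E :=
  (z.2, -(g z.1).inverse (christoffelForm g z.1 z.2))

lemma metric_geodesicField {g : E → E →L[ℝ] E →L[ℝ] ℝ} {z : E × E}
    (hz : (g z.1).IsInvertible) (w : E) :
    g z.1 (geodesicField g z).2 w = -christoffelForm g z.1 z.2 w := by
  obtain ⟨e, he⟩ := hz
  simp [geodesicField, ← he]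

/-- Raises the index: since `g` is invertible, the equation tested against all `w` determines the
acceleration. -/
lemma eq_geodesicField {g : E → E →L[ℝ] E →L[ℝ] ℝ} {z : E × E} {b : E}
    (hz : (g z.1).IsInvertible) (hb : ∀ w, g z.1 b w + christoffelForm g z.1 z.2 w = 0) :
    b = (geodesicField g z).2 := by
  have h1 : g z.1 b = g z.1 (geodesicField g z).2 := by
    ext w
    rw [metric_geodesicField hz]
    exact eq_neg_of_add_eq_zero_left (hb w)
  obtain ⟨e, he⟩ := hz
  rw [← he] at h1
  exact e.injective h1


lemma contDiffOn_geodesicField [FiniteDimensional ℝ E] {g : E → E →L[ℝ] E →L[ℝ] ℝ} {U : Set E}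
    (hU : IsOpen U) (hg : ContDiffOn ℝ ∞ g U) (hinv : ∀ u ∈ U, (g u).IsInvertible) :
    ContDiffOn ℝ ∞ (geodesicField g) (U ×ˢ univ) := by
  have hG : ContDiffOn ℝ ∞ (fun z : E × E => g z.1) (U ×ˢ univ) :=
    hg.comp contDiff_fst.contDiffOn (fun z hz => hz.1)
  have hD : ContDiffOn ℝ ∞ (fun z : E × E => fderiv ℝ g z.1) (U ×ˢ univ) :=
    (hg.fderiv_of_isOpen hU (m := ∞) (by simp)).comp contDiff_fst.contDiffOn (fun z hz => hz.1)
  have hC : ContDiffOn ℝ ∞ (fun z : E × E => christoffelForm g z.1 z.2) (U ×ˢ univ) := by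
    rw [contDiffOn_clm_apply]
    intro w
    simp only [christoffelForm_apply]
    have h2 : ContDiffOn ℝ ∞ (fun z : E × E => z.2) (U ×ˢ univ) := contDiff_snd.contDiffOn
    exact (((hD.clm_apply h2).clm_apply h2).clm_apply contDiffOn_const).sub
      (contDiffOn_const.mul (((hD.clm_apply contDiffOn_const).clm_apply h2).clm_apply h2))
  refine contDiff_snd.contDiffOn.prodMk (ContDiffOn.neg (ContDiffOn.clm_apply ?_ hC))
  intro z hz
  have hI : ContDiffAt ℝ ∞ (ContinuousLinearMap.inverse (R := ℝ) (M := E) (M₂ := E →L[ℝ] ℝ))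
      (g z.1) := by
    obtain ⟨e, he⟩ := hinv z.1 hz.1
    exact he ▸ contDiffAt_map_inverse e
  exact hI.comp_contDiffWithinAt z (hG z hz)


/-- The squared speed is a first integral of the geodesic field. -/
lemma hasDerivAt_metric_self {g : E → E →L[ℝ] E →L[ℝ] ℝ} {z : ℝ → E × E} {t : ℝ}
    (hg : DifferentiableAt ℝ g (z t).1) (hinv : (g (z t).1).IsInvertible)
    (hsymm : ∀ a b, g (z t).1 a b = g (z t).1 b a)
    (hz : HasDerivAt z (geodesicField g (z t)) t) :
    HasDerivAt (fun s => g (z s).1 (z s).2 (z s).2) 0 t := by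
  have h1 := hg.hasFDerivAt.comp_hasDerivAt t hz.fst
  have h2 := (h1.clm_apply hz.snd).clm_apply hz.snd
  refine h2.congr_deriv ?_
  have e1 : (geodesicField g (z t)).1 = (z t).2 := rfl
  have e2 := metric_geodesicField hinv (z t).2
  simp only [add_apply, Function.comp_apply]
  rw [hsymm (z t).2, e2, christoffelForm_apply, e1]
  ring

end CoordinateMetric

/-! ### From geodesics on the manifold to integral curves in charts. -/

noncomputable section GeodesicEquation

variable {m : ℕ} {M : Type*} [TopologicalSpace M] [ChartedSpace (EuclideanSpace ℝ (Fin m)) M]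

local notation "𝔼" => EuclideanSpace ℝ (Fin m)

/-- Position and velocity of a curve in the preferred chart at `p`. -/
def phaseCoord (p : M) (γ : ℝ → M) (t : ℝ) : 𝔼 × 𝔼 :=
  (extChartAt (𝓡 m) p (γ t), deriv (fun s => extChartAt (𝓡 m) p (γ s)) t)

/-- The tangent vector with position `z.1` and velocity `z.2` in the preferred chart at `p`. -/
def tangentOfCoord (p : M) (z : 𝔼 × 𝔼) : TangentBundle (𝓡 m) M :=
  ⟨(extChartAt (𝓡 m) p).symm z.1, mfderiv (𝓡 m) (𝓡 m) (extChartAt (𝓡 m) p).symm z.1 z.2⟩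

lemma velocity_congr {γ γ' : ℝ → M} {t : ℝ} (h : γ =ᶠ[𝓝 t] γ') :
    (⟨γ t, velocity m γ t⟩ : TangentBundle (𝓡 m) M) = ⟨γ' t, velocity m γ' t⟩ := by
  have h1 : γ t = γ' t := h.eq_of_nhds
  have h2 : (velocity m γ t : 𝔼) = (velocity m γ' t : 𝔼) :=
    congrArg (fun L : ℝ →L[ℝ] 𝔼 => L 1) h.mfderiv_eq
  exact TotalSpace.ext h1 (heq_of_eq h2)

section Smooth

variable [IsManifold (𝓡 m) ∞ M]

lemma contDiffAt_extChartAt_comp {n : WithTop ℕ∞} (hn : n ≤ ∞) {p : M} {γ : ℝ → M} {t : ℝ}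
    (hγ : ContMDiffAt 𝓘(ℝ, ℝ) (𝓡 m) n γ t) (ht : γ t ∈ (extChartAt (𝓡 m) p).source) :
    ContDiffAt ℝ n (fun s => extChartAt (𝓡 m) p (γ s)) t := by
  rw [← contMDiffAt_iff_contDiffAt]
  have h : ContMDiffAt (𝓡 m) 𝓘(ℝ, 𝔼) n (extChartAt (𝓡 m) p) (γ t) :=
    (contMDiffAt_extChartAt' (n := ∞) (by rwa [extChartAt_source] at ht)).of_le hn
  exact h.comp t hγ

lemma tangentOfCoord_phaseCoord {p : M} {γ : ℝ → M} {t : ℝ}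
    (hγ : MDifferentiableAt 𝓘(ℝ, ℝ) (𝓡 m) γ t) (ht : γ t ∈ (extChartAt (𝓡 m) p).source) :
    (⟨γ t, velocity m γ t⟩ : TangentBundle (𝓡 m) M) = tangentOfCoord p (phaseCoord p γ t) := by
  have hev : γ =ᶠ[𝓝 t]
      ((extChartAt (𝓡 m) p).symm ∘ (fun s => extChartAt (𝓡 m) p (γ s))) := by
    filter_upwards [hγ.continuousAt.preimage_mem_nhds
      ((isOpen_extChartAt_source (I := 𝓡 m) p).mem_nhds ht)] with s hs
    exact ((extChartAt (𝓡 m) p).left_inv hs).symm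
  rw [velocity_congr hev]
  have hsym := mdifferentiableAt_extChartAt_symm p ((extChartAt (𝓡 m) p).map_source ht)
  have hext : MDifferentiableAt (𝓡 m) 𝓘(ℝ, 𝔼) (extChartAt (𝓡 m) p) (γ t) :=
    (contMDiffAt_extChartAt' (n := ∞) (by rwa [extChartAt_source] at ht)).mdifferentiableAt (by simp)
  have hc : MDifferentiableAt 𝓘(ℝ, ℝ) 𝓘(ℝ, 𝔼) (fun s => extChartAt (𝓡 m) p (γ s)) t :=
    hext.comp t hγ
  have hcomp := mfderiv_comp t (hsym : MDifferentiableAt (𝓡 m) (𝓡 m) (extChartAt (𝓡 m) p).symm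
    ((fun s => extChartAt (𝓡 m) p (γ s)) t)) hc
  refine TotalSpace.ext rfl (heq_of_eq ?_)
  simp only [velocity, hcomp]
  rw [mfderiv_eq_fderiv]
  rfl

/-- Completeness prescribes an initial vector in the tangent bundle; this lets its chart coordinates
be read off. -/
lemma tangentOfCoord_injOn (p : M) :
    InjOn (tangentOfCoord (m := m) p) ((extChartAt (𝓡 m) p).target ×ˢ univ) := by
  rintro ⟨u, a⟩ hu ⟨u', a'⟩ hu' h
  have h1 : u = u' := by
    have := congrArg TotalSpace.proj h
    exact (extChartAt (𝓡 m) p).symm.injOn hu.1 hu'.1 this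
  subst h1
  have h2 := eq_of_heq (TotalSpace.mk.inj h).2
  exact Prod.ext rfl (injective_mfderiv_extChartAt_symm p hu.1 h2)

end Smooth

variable [RiemannianBundle (fun x : M => TangentSpace (𝓡 m) x)]

lemma norm_sq_tangentOfCoord (p : M) (z : 𝔼 × 𝔼) :
    ‖(tangentOfCoord p z).2‖ ^ 2 = metricForm p z.1 z.2 z.2 := by
  rw [metricForm_apply, chartMetric]
  exact (real_inner_self_eq_norm_sq _).symm

lemma norm_sq_velocity [IsManifold (𝓡 m) ∞ M] {p : M} {γ : ℝ → M} {t : ℝ}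
    (hγ : MDifferentiableAt 𝓘(ℝ, ℝ) (𝓡 m) γ t) (ht : γ t ∈ (extChartAt (𝓡 m) p).source) :
    ‖velocity m γ t‖ ^ 2 =
      metricForm (m := m) p (phaseCoord p γ t).1 (phaseCoord p γ t).2 (phaseCoord p γ t).2 := by
  rw [← norm_sq_tangentOfCoord, ← tangentOfCoord_phaseCoord hγ ht]

variable [IsManifold (𝓡 m) ∞ M]

/-- Positivity makes the map to the dual injective, and both spaces have the same finite dimension.
-/
lemma isInvertible_metricForm (p : M) {u : 𝔼} (hu : u ∈ (extChartAt (𝓡 m) p).target) :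
    (metricForm (m := m) p u).IsInvertible := by
  have hinj : Function.Injective (metricForm (m := m) p u) := by
    rw [injective_iff_map_eq_zero]
    intro a ha
    by_contra hne
    exact (metricForm_pos p hu hne).ne' (by rw [ha]; rfl)
  have hrank : Module.finrank ℝ 𝔼 = Module.finrank ℝ (𝔼 →L[ℝ] ℝ) := by
    rw [← (LinearMap.toContinuousLinearMap (𝕜 := ℝ) (E := 𝔼) (F' := ℝ)).finrank_eq]
    exact (Subspace.dual_finrank_eq (K := ℝ) (V := 𝔼)).symm
  refine ⟨(LinearEquiv.ofInjectiveOfFinrankEq (metricForm (m := m) p u : 𝔼 →ₗ[ℝ] 𝔼 →L[ℝ] ℝ)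
    hinj hrank).toContinuousLinearEquiv, ?_⟩
  ext a b
  rfl

variable [IsContMDiffRiemannianBundle (𝓡 m) ∞ (EuclideanSpace ℝ (Fin m))
      (fun x : M => TangentSpace (𝓡 m) x)]

lemma differentiableAt_metricForm (p : M) {u : 𝔼} (hu : u ∈ (extChartAt (𝓡 m) p).target) :
    DifferentiableAt ℝ (metricForm (m := m) p) u :=
  ((contDiffOn_metricForm p).contDiffAt ((isOpen_extChartAt_target (I := 𝓡 m) p).mem_nhds hu)
    ).differentiableAt (by simp)

lemma fderiv_chartMetric (p : M) {u : 𝔼} (hu : u ∈ (extChartAt (𝓡 m) p).target) (a b w : 𝔼) :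
    fderiv ℝ (fun z => chartMetric m p z a b) u w = fderiv ℝ (metricForm p) u w a b := by
  have h := (((differentiableAt_metricForm p hu).hasFDerivAt.clm_apply
    (hasFDerivAt_const a u)).clm_apply (hasFDerivAt_const b u)).fderiv
  simp only [metricForm_apply] at h
  rw [h]
  simp

lemma chartChristoffel_self (p : M) {u : 𝔼} (hu : u ∈ (extChartAt (𝓡 m) p).target) (a w : 𝔼) :
    chartChristoffel m p u a a w = christoffelForm (metricForm p) u a w := by
  rw [chartChristoffel, christoffelForm_apply]
  simp only [fderiv_chartMetric p hu]
  ring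

lemma contDiffOn_geodesicField_metricForm (p : M) :
    ContDiffOn ℝ ∞ (geodesicField (metricForm (m := m) p))
      ((extChartAt (𝓡 m) p).target ×ˢ univ) :=
  contDiffOn_geodesicField (isOpen_extChartAt_target (I := 𝓡 m) p) (contDiffOn_metricForm p)
    (fun _ hu => isInvertible_metricForm p hu)

namespace IsGeodesic

variable {γ : ℝ → M}

omit [IsContMDiffRiemannianBundle (𝓡 m) ∞ (EuclideanSpace ℝ (Fin m))
      (fun x : M => TangentSpace (𝓡 m) x)] [IsManifold (𝓡 m) ∞ M] in
lemma mdifferentiableAt (hγ : IsGeodesic m γ) (t : ℝ) :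
    MDifferentiableAt 𝓘(ℝ, ℝ) (𝓡 m) γ t :=
  (hγ.1 t).mdifferentiableAt (by simp)

omit [IsContMDiffRiemannianBundle (𝓡 m) ∞ (EuclideanSpace ℝ (Fin m))
      (fun x : M => TangentSpace (𝓡 m) x)] in
lemma contDiffAt_coord (hγ : IsGeodesic m γ) {p : M} {t : ℝ}
    (ht : γ t ∈ (extChartAt (𝓡 m) p).source) :
    ContDiffAt ℝ ∞ (fun s => extChartAt (𝓡 m) p (γ s)) t :=
  contDiffAt_extChartAt_comp le_rfl (hγ.1 t) ht

lemma hasDerivAt_phaseCoord (hγ : IsGeodesic m γ) {p : M} {t : ℝ}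
    (ht : γ t ∈ (extChartAt (𝓡 m) p).source) :
    HasDerivAt (phaseCoord (m := m) p γ) (geodesicField (metricForm p) (phaseCoord p γ t)) t := by
  have hc := hγ.contDiffAt_coord ht
  have h1 : HasDerivAt (fun s => extChartAt (𝓡 m) p (γ s)) (phaseCoord p γ t).2 t :=
    (hc.differentiableAt (by simp)).hasDerivAt
  have h2 : HasDerivAt (deriv fun s => extChartAt (𝓡 m) p (γ s))
      (deriv (deriv fun s => extChartAt (𝓡 m) p (γ s)) t) t := by
    have h2 : ContDiffAt ℝ 1 (deriv fun s => extChartAt (𝓡 m) p (γ s)) t := by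
      have := (hc.fderiv_right (m := 1) (by norm_cast)).clm_apply
        (contDiffAt_const (c := (1 : ℝ)))
      exact this
    exact (h2.differentiableAt (by simp)).hasDerivAt
  have hmem : (phaseCoord (m := m) p γ t).1 ∈ (extChartAt (𝓡 m) p).target :=
    (extChartAt (𝓡 m) p).map_source ht
  have h3 : deriv (deriv fun s => extChartAt (𝓡 m) p (γ s)) t
      = (geodesicField (metricForm p) (phaseCoord p γ t)).2 := by
    refine eq_geodesicField (isInvertible_metricForm p hmem) (fun w => ?_)
    rw [← chartChristoffel_self p hmem]
    exact hγ.2 p t (by rwa [extChartAt_source] at ht) w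
  rw [h3] at h2
  exact h1.prodMk h2

lemma hasDerivAt_norm_sq_velocity (hγ : IsGeodesic m γ) (t : ℝ) :
    HasDerivAt (fun s => ‖velocity m γ s‖ ^ 2) 0 t := by
  have ht : γ t ∈ (extChartAt (𝓡 m) (γ t)).source := mem_extChartAt_source _
  set p := γ t with hp
  have hmem : (phaseCoord (m := m) p γ t).1 ∈ (extChartAt (𝓡 m) p).target :=
    (extChartAt (𝓡 m) p).map_source ht
  have hev : (fun s => ‖velocity m γ s‖ ^ 2) =ᶠ[𝓝 t] fun s =>
      metricForm (m := m) p (phaseCoord p γ s).1 (phaseCoord p γ s).2 (phaseCoord p γ s).2 := by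
    filter_upwards [(hγ.mdifferentiableAt t).continuousAt.preimage_mem_nhds
      ((isOpen_extChartAt_source (I := 𝓡 m) p).mem_nhds ht)] with s hs
    exact norm_sq_velocity (hγ.mdifferentiableAt s) hs
  exact (hasDerivAt_metric_self (differentiableAt_metricForm p hmem)
    (isInvertible_metricForm p hmem) (metricForm_symm p _)
    (hasDerivAt_phaseCoord hγ ht)).congr_of_eventuallyEq hev

/-- Bridges two conventions: `IsYlManifold` asks for unit speed at time `0` only, `FocusesWithin` at
all times. -/
lemma norm_velocity_eq (hγ : IsGeodesic m γ) (t s : ℝ) :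
    ‖velocity m γ t‖ = ‖velocity m γ s‖ := by
  have h := is_const_of_deriv_eq_zero
    (fun t => (hγ.hasDerivAt_norm_sq_velocity t).differentiableAt)
    (fun t => (hγ.hasDerivAt_norm_sq_velocity t).deriv) t s
  exact (sq_eq_sq₀ (norm_nonneg _) (norm_nonneg _)).1 h

omit [IsContMDiffRiemannianBundle (𝓡 m) ∞ (EuclideanSpace ℝ (Fin m))
      (fun x : M => TangentSpace (𝓡 m) x)] [IsManifold (𝓡 m) ∞ M] in
lemma comp_add_const (hγ : IsGeodesic m γ) (a : ℝ) : IsGeodesic m (fun t => γ (t + a)) := by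
  refine ⟨hγ.1.comp (by rw [contMDiff_iff_contDiff]; fun_prop), ?_⟩
  intro p t ht c w
  have hd : deriv c = fun s => deriv (fun s => extChartAt (𝓡 m) p (γ s)) (s + a) := by
    funext s
    exact deriv_comp_add_const (fun s => extChartAt (𝓡 m) p (γ s)) a s
  have hdd : deriv (deriv c) t = deriv (deriv (fun s => extChartAt (𝓡 m) p (γ s))) (t + a) := by
    rw [hd]
    exact deriv_comp_add_const (deriv (fun s => extChartAt (𝓡 m) p (γ s))) a t
  rw [hdd, hd]
  exact hγ.2 p (t + a) ht w

omit [IsContMDiffRiemannianBundle (𝓡 m) ∞ (EuclideanSpace ℝ (Fin m))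
      (fun x : M => TangentSpace (𝓡 m) x)] [IsManifold (𝓡 m) ∞ M] in
lemma comp_neg (hγ : IsGeodesic m γ) : IsGeodesic m (fun t => γ (-t)) := by
  refine ⟨hγ.1.comp (by rw [contMDiff_iff_contDiff]; fun_prop), ?_⟩
  intro p t ht c w
  have hd : deriv c = fun s => -deriv (fun s => extChartAt (𝓡 m) p (γ s)) (-s) := by
    funext s
    exact deriv_comp_neg (fun s => extChartAt (𝓡 m) p (γ s)) s
  have hdd : deriv (deriv c) t = deriv (deriv (fun s => extChartAt (𝓡 m) p (γ s))) (-t) := by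
    rw [hd, deriv.fun_neg, deriv_comp_neg (deriv (fun s => extChartAt (𝓡 m) p (γ s))), neg_neg]
  rw [hdd, hd]
  -- The Christoffel term is quadratic in the velocity, so reversing time does not change it.
  have hneg : ∀ b : 𝔼, chartChristoffel m p (c t) (-b) (-b) w
      = chartChristoffel m p (c t) b b w := by
    intro b
    have h1 : ∀ z (a : 𝔼), chartMetric m p z (-b) a = -chartMetric m p z b a := fun z a => by
      simp only [← metricForm_apply, map_neg]; rfl
    have h2 : ∀ z, chartMetric m p z (-b) (-b) = chartMetric m p z b b := fun z => by
      simp only [← metricForm_apply, map_neg]; simp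
    simp only [chartChristoffel, h2]
    simp only [h1, map_neg, fderiv_fun_neg, neg_apply, neg_neg]
  rw [hneg]
  exact hγ.2 p (-t) ht w

end IsGeodesic

end GeodesicEquation

/-! ### Short geodesics are minimal: a calibration in coordinates. -/

noncomputable section EnergyComparison

variable {E : Type*} [NormedAddCommGroup E] [InnerProductSpace ℝ E]

/-- Second order lower bound for the energy density of a perturbed curve. -/
lemma energy_density_lower_bound {g₀ g₁ dg : E →L[ℝ] E →L[ℝ] ℝ} {c L K q q' : ℝ} {h v k : E}
    (hc : 0 < c) (hK : 0 ≤ K) (hsymm : g₁ v k = g₁ k v)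
    (hcoer₁ : c * ‖k‖ ^ 2 ≤ g₁ k k) (hv : ‖v‖ ^ 2 ≤ 1 / c) (hunit : g₀ v v = 1)
    (hLip : ‖g₁ - g₀‖ ≤ L * ‖h‖) (hTay : ‖g₁ - g₀ - dg‖ ≤ K * ‖h‖ ^ 2)
    (hq : 2 * q ^ 2 / c + (2 * L ^ 2 / c ^ 2 + K / c) ≤ q') :
    1 + 2 * g₀ v k + dg v v - (q' * ‖h‖ ^ 2 + 2 * q * inner ℝ h k) ≤ g₁ (v + k) (v + k) := by
  have h1 : |g₁ v k - g₀ v k| ≤ L * ‖h‖ * ‖v‖ * ‖k‖ := by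
    calc |g₁ v k - g₀ v k| = ‖(g₁ - g₀) v k‖ := by simp
      _ ≤ ‖g₁ - g₀‖ * ‖v‖ * ‖k‖ := (g₁ - g₀).le_opNorm₂ v k
      _ ≤ L * ‖h‖ * ‖v‖ * ‖k‖ := by gcongr
  have h2 : |g₁ v v - g₀ v v - dg v v| ≤ K * ‖h‖ ^ 2 * (1 / c) := by
    calc |g₁ v v - g₀ v v - dg v v| = ‖(g₁ - g₀ - dg) v v‖ := by simp
      _ ≤ ‖g₁ - g₀ - dg‖ * ‖v‖ * ‖v‖ := (g₁ - g₀ - dg).le_opNorm₂ v v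
      _ = ‖g₁ - g₀ - dg‖ * ‖v‖ ^ 2 := by ring
      _ ≤ K * ‖h‖ ^ 2 * (1 / c) := by gcongr
  -- Here and in `h4`, Young's inequality spends half of the coercive term `c * ‖k‖ ^ 2` on each
  -- mixed term in `h` and `k`.
  have h3 : 2 * (L * ‖h‖ * ‖v‖ * ‖k‖) ≤ c / 2 * ‖k‖ ^ 2 + 2 * L ^ 2 / c ^ 2 * ‖h‖ ^ 2 := by
    have h30 : 2 * (L * ‖h‖ * ‖v‖ * ‖k‖) ≤
        c / 2 * ‖k‖ ^ 2 + 2 * L ^ 2 / c * ‖h‖ ^ 2 * ‖v‖ ^ 2 := by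
      have hsq := mul_nonneg (by positivity : 0 ≤ 1 / (2 * c))
        (sq_nonneg (c * ‖k‖ - 2 * L * ‖h‖ * ‖v‖))
      have : 1 / (2 * c) * (c * ‖k‖ - 2 * L * ‖h‖ * ‖v‖) ^ 2 =
          c / 2 * ‖k‖ ^ 2 + 2 * L ^ 2 / c * ‖h‖ ^ 2 * ‖v‖ ^ 2
            - 2 * (L * ‖h‖ * ‖v‖ * ‖k‖) := by
        field_simp
        ring
      linarith
    have h31 : 2 * L ^ 2 / c * ‖h‖ ^ 2 * ‖v‖ ^ 2 ≤ 2 * L ^ 2 / c * ‖h‖ ^ 2 * (1 / c) := by gcongr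
    have h32 : 2 * L ^ 2 / c * ‖h‖ ^ 2 * (1 / c) = 2 * L ^ 2 / c ^ 2 * ‖h‖ ^ 2 := by
      field_simp
    linarith
  have h4 : -(c / 2 * ‖k‖ ^ 2 + 2 * q ^ 2 / c * ‖h‖ ^ 2) ≤ 2 * q * inner ℝ h k := by
    have hsq := mul_nonneg (by positivity : 0 ≤ 1 / (2 * c))
      (sq_nonneg (c * ‖k‖ - 2 * |q| * ‖h‖))
    have he : 1 / (2 * c) * (c * ‖k‖ - 2 * |q| * ‖h‖) ^ 2 =
        c / 2 * ‖k‖ ^ 2 + 2 * |q| ^ 2 / c * ‖h‖ ^ 2 - 2 * |q| * (‖h‖ * ‖k‖) := by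
      field_simp
      ring
    rw [sq_abs] at he
    have h40 : |2 * q * inner ℝ h k| ≤ 2 * |q| * (‖h‖ * ‖k‖) := by
      rw [abs_mul, abs_mul, abs_two]
      gcongr
      exact abs_real_inner_le_norm h k
    have := neg_abs_le (2 * q * inner ℝ h k)
    linarith
  have h5 : g₁ (v + k) (v + k) = g₁ v v + 2 * g₁ v k + g₁ k k := by
    simp only [map_add, add_apply]
    rw [hsymm]
    ring
  have h6 := mul_le_mul_of_nonneg_right hq (sq_nonneg ‖h‖)
  have h7 : K * ‖h‖ ^ 2 * (1 / c) = K / c * ‖h‖ ^ 2 := by ring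
  have h8 := (abs_le.1 h1).1
  have h9 := (abs_le.1 h2).1
  rw [h5]
  nlinarith

/-- In coordinates, a unit speed geodesic on a short time interval is not longer than any curve
with the same end points. -/
lemma geodesic_length_le {g : E → E →L[ℝ] E →L[ℝ] ℝ} {D : Set E} {c L K A a b : ℝ}
    (hc : 0 < c) (hK : 0 ≤ K) (hA : 2 * L ^ 2 / c ^ 2 + K / c ≤ A) (hA0 : 0 < A)
    (hsymm : ∀ u ∈ D, ∀ x y, g u x y = g u y x)
    (hcoer : ∀ u ∈ D, ∀ x, c * ‖x‖ ^ 2 ≤ g u x x)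
    (hdiff : ∀ u ∈ D, DifferentiableAt ℝ g u)
    (hinv : ∀ u ∈ D, (g u).IsInvertible)
    (hLip : ∀ u ∈ D, ∀ u' ∈ D, ‖g u' - g u‖ ≤ L * ‖u' - u‖)
    (hTay : ∀ u ∈ D, ∀ u' ∈ D, ‖g u' - g u - fderiv ℝ g u (u' - u)‖ ≤ K * ‖u' - u‖ ^ 2)
    (hshort : 8 * A * (b - a) ^ 2 ≤ c)
    {z : ℝ → E × E} (hz : ∀ t ∈ Icc a b, HasDerivAt z (geodesicField g (z t)) t)
    (hzD : ∀ t ∈ Icc a b, (z t).1 ∈ D)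
    (hunit : ∀ t ∈ Icc a b, g (z t).1 (z t).2 (z t).2 = 1)
    {s s' : ℝ → E} (hs : ContinuousOn s (Icc 0 1)) (hsD : ∀ t ∈ Icc (0 : ℝ) 1, s t ∈ D)
    (hs' : ∀ t ∈ Ioo (0 : ℝ) 1, HasDerivAt s (s' t) t)
    (hs0 : s 0 = (z a).1) (hs1 : s 1 = (z b).1)
    {W w : ℝ → ℝ} (hW : ContinuousOn W (Icc 0 1))
    (hW' : ∀ t ∈ Ioo (0 : ℝ) 1, HasDerivAt W (w t) t) (hW0 : W 0 = 0)
    (hw0 : ∀ t ∈ Ioo (0 : ℝ) 1, 0 ≤ w t)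
    (hw : ∀ t ∈ Ioo (0 : ℝ) 1, w t ^ 2 = g (s t) (s' t) (s' t)) :
    b - a ≤ W 1 := by
  by_contra! hlt
  set η := b - a - W 1 with hη
  have hη0 : 0 < η := by linarith
  -- Under the contrary assumption, time on the geodesic is matched with arc length on the
  -- competitor; the correction `η * t` makes `τ` end at `b` and have positive speed even where the
  -- competitor stops.
  set τ : ℝ → ℝ := fun t => a + W t + η * t with hτ
  have hτcont : ContinuousOn τ (Icc 0 1) := by
    have : ContinuousOn (fun t : ℝ => η * t) (Icc 0 1) := by fun_prop
    exact (continuousOn_const.add hW).add this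
  have hτ' : ∀ t ∈ Ioo (0 : ℝ) 1, HasDerivAt τ (w t + η) t := by
    intro t ht
    have h1 := ((hW' t ht).const_add a).add ((hasDerivAt_id t).const_mul η)
    exact h1.congr_deriv (by simp)
  have hτmono : MonotoneOn τ (Icc 0 1) := by
    refine monotoneOn_of_deriv_nonneg (convex_Icc 0 1) hτcont ?_ ?_
    · rw [interior_Icc]
      exact fun t ht => (hτ' t ht).differentiableAt.differentiableWithinAt
    · rw [interior_Icc]
      intro t ht
      rw [(hτ' t ht).deriv]
      linarith [hw0 t ht]
  have hτ0 : τ 0 = a := by simp [hτ, hW0]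
  have hτ1 : τ 1 = b := by simp [hτ, hη]
  have hτmem : ∀ t ∈ Icc (0 : ℝ) 1, τ t ∈ Icc a b := by
    intro t ht
    refine ⟨?_, ?_⟩
    · rw [← hτ0]
      exact hτmono (left_mem_Icc.2 zero_le_one) ht ht.1
    · rw [← hτ1]
      exact hτmono ht (right_mem_Icc.2 zero_le_one) ht.2
  have hgz : ∀ t ∈ Icc a b, HasDerivAt (fun x => g (z x).1) (fderiv ℝ g (z t).1 (z t).2) t :=
    fun t ht => (hdiff _ (hzD t ht)).hasFDerivAt.comp_hasDerivAt t (hz t ht).fst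
  have hzcont : ContinuousOn z (Icc a b) := fun t ht => (hz t ht).continuousAt.continuousWithinAt
  have hgzcont : ContinuousOn (fun x => g (z x).1) (Icc a b) :=
    fun t ht => (hgz t ht).continuousAt.continuousWithinAt
  set h : ℝ → E := fun t => s t - (z (τ t)).1 with hh
  have hzτ : ContinuousOn (fun t => z (τ t)) (Icc 0 1) := hzcont.comp hτcont hτmem
  have hgzτ : ContinuousOn (fun t => g (z (τ t)).1) (Icc 0 1) := hgzcont.comp hτcont hτmem
  have hhcont : ContinuousOn h (Icc 0 1) := hs.sub hzτ.fst
  -- Calibration minus length. The linear term in `h` is the first variation, the quadratic one pays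
  -- for second order errors, and both vanish at the end points, where `h = 0`. Monotonicity of `Ψ`
  -- then yields `b - W 1 ≤ a`.
  set Ψ : ℝ → ℝ := fun t => τ t + 2 * g (z (τ t)).1 (z (τ t)).2 (h t)
    - 2 * A * (τ t - a) * ‖h t‖ ^ 2 - W t with hΨ
  have hΨcont : ContinuousOn Ψ (Icc 0 1) := by
    have h1 : ContinuousOn (fun t => g (z (τ t)).1 (z (τ t)).2 (h t)) (Icc 0 1) :=
      (hgzτ.clm_apply hzτ.snd).clm_apply hhcont
    exact ((hτcont.add (continuousOn_const.mul h1)).sub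
      ((continuousOn_const.mul (hτcont.sub continuousOn_const)).mul (hhcont.norm.pow 2))).sub hW
  have hΨ' : ∀ t ∈ Ioo (0 : ℝ) 1, ∃ d ≤ 0, HasDerivAt Ψ d t := by
    intro t ht
    have htI := Ioo_subset_Icc_self ht
    have hτt := hτmem t htI
    set ρ := w t + η with hρ
    have hρ0 : 0 < ρ := by linarith [hw0 t ht]
    set u := (z (τ t)).1 with hu
    set v := (z (τ t)).2 with hv
    have huD : u ∈ D := hzD _ hτt
    set k : E := ρ⁻¹ • s' t - v with hk
    have hs'k : s' t = ρ • (v + k) := by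
      rw [hk, add_sub_cancel, smul_inv_smul₀ hρ0.ne']
    have hzd : HasDerivAt (fun t => z (τ t)) (ρ • geodesicField g (z (τ t))) t :=
      (hz _ hτt).scomp t (hτ' t ht)
    have hud : HasDerivAt (fun t => (z (τ t)).1) (ρ • v) t := hzd.fst
    have hvd : HasDerivAt (fun t => (z (τ t)).2) (ρ • (geodesicField g (z (τ t))).2) t := hzd.snd
    have hgd : HasDerivAt (fun t => g (z (τ t)).1) (ρ • fderiv ℝ g u v) t :=
      (hgz _ hτt).scomp t (hτ' t ht)
    have hhd : HasDerivAt h (ρ • k) t := by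
      refine ((hs' t ht).sub hud).congr_deriv ?_
      rw [hs'k, ← smul_sub, add_sub_cancel_left]
    have hfirst := ((hgd.clm_apply hvd).clm_apply hhd).const_mul 2
    have hnorm := (((hτ' t ht).sub_const a).const_mul (2 * A)).mul hhd.norm_sq
    have htot := (((hτ' t ht).add hfirst).sub hnorm).sub (hW' t ht)
    refine ⟨_, ?_, htot⟩
    have hgeo := metric_geodesicField (z := z (τ t)) (hinv u huD) (h t)
    rw [christoffelForm_apply] at hgeo
    -- A Riccati inequality for `q = 2 * A * (τ - a)`, with `q' = 2 * A`: one `A` pays for `2 * q ^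
    -- 2 / c` by `hshort`, the other for the constants by `hA`.
    have hq : 2 * (2 * A * (τ t - a)) ^ 2 / c + (2 * L ^ 2 / c ^ 2 + K / c) ≤ 2 * A := by
      have h1 : (τ t - a) ^ 2 ≤ (b - a) ^ 2 :=
        pow_le_pow_left₀ (by linarith [hτt.1]) (by linarith [hτt.2]) 2
      have h2 : 2 * (2 * A * (τ t - a)) ^ 2 / c ≤ A := by
        rw [div_le_iff₀ hc]
        nlinarith [mul_le_mul_of_nonneg_left h1 hA0.le]
      linarith
    have hvle : ‖v‖ ^ 2 ≤ 1 / c := by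
      rw [le_div_iff₀ hc, mul_comm]
      exact (hcoer u huD v).trans_eq (hunit _ hτt)
    have hmain := energy_density_lower_bound (h := h t) (v := v) (k := k) hc hK
      (hsymm _ (hsD t htI) v k) (hcoer _ (hsD t htI) k) hvle (hunit _ hτt)
      (hLip u huD _ (hsD t htI)) (hTay u huD _ (hsD t htI)) hq
    have hww : w t ^ 2 = ρ ^ 2 * g (s t) (v + k) (v + k) := by
      rw [hw t ht, hs'k]
      simp only [map_smul, smul_apply, smul_eq_mul]
      ring
    -- Energy is at most length here: the left side is `w ^ 2 / ρ`, and `w ≤ ρ`.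
    have hle : ρ * g (s t) (v + k) (v + k) ≤ w t := by
      have h1 : ρ * (ρ * g (s t) (v + k) (v + k)) ≤ ρ * w t := by
        calc ρ * (ρ * g (s t) (v + k) (v + k)) = w t ^ 2 := by rw [hww]; ring
          _ ≤ ρ * w t := by nlinarith [hw0 t ht]
      exact le_of_mul_le_mul_left h1 hρ0
    have hmul := mul_le_mul_of_nonneg_left hmain hρ0.le
    simp only [add_apply, smul_apply, map_smul, smul_eq_mul, real_inner_smul_right, ← hu, ← hv]
      at hgeo ⊢
    rw [hgeo]
    linarith
  have hanti : AntitoneOn Ψ (Icc 0 1) := by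
    refine antitoneOn_of_deriv_nonpos (convex_Icc 0 1) hΨcont ?_ ?_
    · rw [interior_Icc]
      intro t ht
      obtain ⟨d, -, hd⟩ := hΨ' t ht
      exact hd.differentiableAt.differentiableWithinAt
    · rw [interior_Icc]
      intro t ht
      obtain ⟨d, hd0, hd⟩ := hΨ' t ht
      rwa [hd.deriv]
  have hfin := hanti (left_mem_Icc.2 zero_le_one) (right_mem_Icc.2 zero_le_one) zero_le_one
  have hh0 : h 0 = 0 := by simp [hh, hτ0, hs0]
  have hh1 : h 1 = 0 := by simp [hh, hτ1, hs1]
  simp only [hΨ, hh0, hh1, hτ0, hτ1, hW0, map_zero, norm_zero] at hfin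
  simp only [ne_eq, OfNat.ofNat_ne_zero, not_false_eq_true, zero_pow, mul_zero, add_zero,
    sub_zero] at hfin
  linarith

end EnergyComparison

/-! ### Uniform constants on compact convex sets. -/

noncomputable section CompactBounds

variable {E F : Type*} [NormedAddCommGroup E] [NormedSpace ℝ E]
  [NormedAddCommGroup F] [NormedSpace ℝ F]

lemma exists_norm_sub_le_of_contDiffOn {f : E → F} {U D : Set E} (hU : IsOpen U)
    (hf : ContDiffOn ℝ 1 f U) (hD : IsCompact D) (hconv : Convex ℝ D) (hDU : D ⊆ U) :
    ∃ L : ℝ, 0 ≤ L ∧ ∀ u ∈ D, ∀ u' ∈ D, ‖f u' - f u‖ ≤ L * ‖u' - u‖ := by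
  have hcont : ContinuousOn (fderiv ℝ f) D :=
    (hf.continuousOn_fderiv_of_isOpen hU le_rfl).mono hDU
  obtain ⟨L, hL⟩ := hD.exists_bound_of_continuousOn hcont
  refine ⟨max L 0, le_max_right _ _, fun u hu u' hu' => ?_⟩
  refine hconv.norm_image_sub_le_of_norm_fderiv_le (𝕜 := ℝ) (fun x hx => ?_)
    (fun x hx => (hL x hx).trans (le_max_left _ _)) hu hu'
  exact (hf.contDiffAt (hU.mem_nhds (hDU hx))).differentiableAt (by simp)

/-- Mean value inequality on the segment, using that the derivative is itself Lipschitz on `D`. -/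
lemma exists_taylor_bound_of_contDiffOn {f : E → F} {U D : Set E} (hU : IsOpen U)
    (hf : ContDiffOn ℝ 2 f U) (hD : IsCompact D) (hconv : Convex ℝ D) (hDU : D ⊆ U) :
    ∃ K : ℝ, 0 ≤ K ∧ ∀ u ∈ D, ∀ u' ∈ D,
      ‖f u' - f u - fderiv ℝ f u (u' - u)‖ ≤ K * ‖u' - u‖ ^ 2 := by
  obtain ⟨K, hK0, hK⟩ := exists_norm_sub_le_of_contDiffOn hU
    (hf.fderiv_of_isOpen hU (m := 1) (by norm_num)) hD hconv hDU
  refine ⟨K, hK0, fun u hu u' hu' => ?_⟩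
  have hseg : segment ℝ u u' ⊆ D := hconv.segment_subset hu hu'
  have h := (convex_segment (𝕜 := ℝ) u u').norm_image_sub_le_of_norm_hasFDerivWithin_le'
    (f := f) (f' := fderiv ℝ f) (φ := fderiv ℝ f u) (C := K * ‖u' - u‖)
    (fun x hx => ((hf.contDiffAt (hU.mem_nhds (hDU (hseg hx)))).differentiableAt
      (by simp)).hasFDerivAt.hasFDerivWithinAt)
    (fun x hx => (hK u hu x (hseg hx)).trans ?_) (left_mem_segment ℝ u u')
    (right_mem_segment ℝ u u')
  · rw [sq, ← mul_assoc]
    exact h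
  · gcongr
    exact norm_sub_le_of_mem_segment hx

/-- The form has a positive lower bound on the compact set `D` times the unit sphere; homogeneity
does the rest. -/
lemma exists_coercive_of_pos [FiniteDimensional ℝ E] {g : E → E →L[ℝ] E →L[ℝ] ℝ} {D : Set E}
    (hD : IsCompact D) (hg : ContinuousOn g D) (hpos : ∀ u ∈ D, ∀ a ≠ 0, 0 < g u a a) :
    ∃ c : ℝ, 0 < c ∧ ∀ u ∈ D, ∀ a, c * ‖a‖ ^ 2 ≤ g u a a := by
  have hK : IsCompact (D ×ˢ Metric.sphere (0 : E) 1) := hD.prod (isCompact_sphere 0 1)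
  have hcont : ContinuousOn (fun z : E × E => g z.1 z.2 z.2) (D ×ˢ Metric.sphere (0 : E) 1) :=
    ((hg.comp continuousOn_fst (fun z hz => hz.1)).clm_apply continuousOn_snd).clm_apply
      continuousOn_snd
  obtain ⟨c, hc, hcle⟩ := hK.exists_forall_le' hcont (a := 0) (fun z hz =>
    hpos z.1 hz.1 z.2 (by
      have := mem_sphere_zero_iff_norm.1 hz.2
      rintro h0
      simp [h0] at this))
  refine ⟨c, hc, fun u hu a => ?_⟩
  rcases eq_or_ne a 0 with rfl | ha
  · simp
  have hn : 0 < ‖a‖ := norm_pos_iff.2 ha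
  have h := hcle (u, ‖a‖⁻¹ • a) ⟨hu, by simp [norm_smul, hn.ne']⟩
  simp only [map_smul, smul_apply, smul_eq_mul] at h
  have h2 := mul_le_mul_of_nonneg_left h (sq_nonneg ‖a‖)
  calc c * ‖a‖ ^ 2 = ‖a‖ ^ 2 * c := mul_comm _ _
    _ ≤ _ := h2
    _ = g u a a := by field_simp

end CompactBounds

/-! ### Length, distance and local minimality. -/

noncomputable section RiemannianDistance

variable {m : ℕ} {M : Type*}

local notation "𝔼" => EuclideanSpace ℝ (Fin m)

section Chart

variable [PseudoMetricSpace M] [ChartedSpace (EuclideanSpace ℝ (Fin m)) M]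

lemma exists_ball_subset_chart (p : M) :
    ∃ r > 0, ∃ R > 0, Metric.closedBall (extChartAt (𝓡 m) p p) R ⊆ (extChartAt (𝓡 m) p).target ∧
      ∀ x, dist x p < r → x ∈ (extChartAt (𝓡 m) p).source ∧
        extChartAt (𝓡 m) p x ∈ Metric.closedBall (extChartAt (𝓡 m) p p) R := by
  obtain ⟨R, hR, hRsub⟩ := Metric.nhds_basis_closedBall.mem_iff.1
    ((isOpen_extChartAt_target (I := 𝓡 m) p).mem_nhds (mem_extChartAt_target (I := 𝓡 m) p))
  have h1 := (continuousAt_extChartAt (I := 𝓡 m) p).preimage_mem_nhds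
    (Metric.closedBall_mem_nhds _ hR)
  have h2 := extChartAt_source_mem_nhds (I := 𝓡 m) p
  obtain ⟨r, hr, hsub⟩ := Metric.mem_nhds_iff.1 (inter_mem h2 h1)
  exact ⟨r, hr, R, hR, hRsub, fun x hx => hsub (Metric.mem_ball.2 hx)⟩

end Chart

variable [MetricSpace M] [ChartedSpace (EuclideanSpace ℝ (Fin m)) M]
  [RiemannianBundle (fun x : M => TangentSpace (𝓡 m) x)]

/-- Unit speed geodesics. -/
def IsUnitGeodesic (m : ℕ) {M : Type*} [MetricSpace M]
    [ChartedSpace (EuclideanSpace ℝ (Fin m)) M]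
    [RiemannianBundle (fun x : M => TangentSpace (𝓡 m) x)] (γ : ℝ → M) : Prop :=
  IsGeodesic m γ ∧ ∀ t, ‖velocity m γ t‖ = 1

lemma pathELength_eq_lintegral_norm_velocity (γ : ℝ → M) (a b : ℝ) :
    Manifold.pathELength (𝓡 m) γ a b
      = ∫⁻ t in Icc a b, ENNReal.ofReal ‖velocity m γ t‖ := by
  rw [Manifold.pathELength_eq_lintegral_mfderiv_Icc]
  simp only [ofReal_norm]
  rfl

lemma IsUnitGeodesic.dist_le [IsRiemannianManifold (𝓡 m) M] {γ : ℝ → M}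
    (hγ : IsUnitGeodesic m γ) (s t : ℝ) : dist (γ s) (γ t) ≤ |s - t| := by
  wlog hst : s ≤ t generalizing s t
  · rw [dist_comm, abs_sub_comm]
    exact this t s (le_of_not_ge hst)
  have h1 : edist (γ s) (γ t) ≤ ENNReal.ofReal (t - s) := by
    rw [IsRiemannianManifold.out (I := 𝓡 m) (γ s) (γ t)]
    refine (Manifold.riemannianEDist_le_pathELength
      ((hγ.1.1.of_le (by norm_cast)).contMDiffOn) rfl rfl hst).trans ?_
    rw [pathELength_eq_lintegral_norm_velocity]
    simp [hγ.2]
  rw [abs_sub_comm, abs_of_nonneg (sub_nonneg.2 hst), dist_edist]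
  exact ENNReal.toReal_le_of_le_ofReal (sub_nonneg.2 hst) h1

variable [IsManifold (𝓡 m) ∞ M]
  [IsContMDiffRiemannianBundle (𝓡 m) ∞ (EuclideanSpace ℝ (Fin m))
      (fun x : M => TangentSpace (𝓡 m) x)]

/-- Makes the arc length of a `C^1` competitor differentiable, as `geodesic_length_le` requires. -/
lemma continuous_norm_velocity {σ : ℝ → M} (hσ : ContMDiff 𝓘(ℝ, ℝ) (𝓡 m) 1 σ) :
    Continuous (fun t => ‖velocity m σ t‖) := by
  rw [continuous_iff_continuousAt]
  intro t
  set p := σ t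
  have ht : σ t ∈ (extChartAt (𝓡 m) p).source := mem_extChartAt_source _
  have hsrc : ∀ᶠ s in 𝓝 t, σ s ∈ (extChartAt (𝓡 m) p).source :=
    hσ.continuous.continuousAt.preimage_mem_nhds
      ((isOpen_extChartAt_source (I := 𝓡 m) p).mem_nhds ht)
  have hev : (fun s => ‖velocity m σ s‖) =ᶠ[𝓝 t] fun s => √(metricForm (m := m) p
      (phaseCoord p σ s).1 (phaseCoord p σ s).2 (phaseCoord p σ s).2) := by
    filter_upwards [hsrc] with s hs
    rw [← norm_sq_velocity ((hσ s).mdifferentiableAt (by simp)) hs,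
      Real.sqrt_sq (norm_nonneg _)]
  have hc : ContDiffAt ℝ 1 (fun s => extChartAt (𝓡 m) p (σ s)) t :=
    contDiffAt_extChartAt_comp (by norm_cast) (hσ t) ht
  have hc' : ContinuousAt (deriv (fun s => extChartAt (𝓡 m) p (σ s))) t :=
    (hc.fderiv_right (m := 0) (by norm_num)).continuousAt.clm_apply continuousAt_const
  have hg : ContinuousAt (metricForm (m := m) p) (extChartAt (𝓡 m) p (σ t)) :=
    (differentiableAt_metricForm p ((extChartAt (𝓡 m) p).map_source ht)).continuousAt
  have hg' : ContinuousAt (fun s => metricForm (m := m) p (extChartAt (𝓡 m) p (σ s))) t :=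
    ContinuousAt.comp (f := fun s => extChartAt (𝓡 m) p (σ s)) hg hc.continuousAt
  refine ContinuousAt.congr ?_ hev.symm
  exact Real.continuous_sqrt.continuousAt.comp ((hg'.clm_apply hc').clm_apply hc')

/-- Unit speed geodesics are locally minimizing, locally uniformly. -/
lemma exists_forall_le_dist_of_isUnitGeodesic [IsRiemannianManifold (𝓡 m) M] (p : M) :
    ∃ r > 0, ∀ γ : ℝ → M, IsUnitGeodesic m γ → ∀ a b : ℝ, dist (γ a) p < r → a ≤ b → b - a < r →
      b - a ≤ dist (γ a) (γ b) := by
  obtain ⟨r, hr, R, hR, hRsub, hball⟩ := exists_ball_subset_chart (m := m) p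
  set D := Metric.closedBall (extChartAt (𝓡 m) p p) R with hD
  have hDc : IsCompact D := isCompact_closedBall _ _
  have hDconv : Convex ℝ D := convex_closedBall _ _
  have hopen := isOpen_extChartAt_target (I := 𝓡 m) p
  have hsmooth := contDiffOn_metricForm (m := m) p
  obtain ⟨c, hc, hcoer⟩ := exists_coercive_of_pos hDc (hsmooth.continuousOn.mono hRsub)
    (fun u hu a ha => metricForm_pos p (hRsub hu) ha)
  obtain ⟨L, -, hLip⟩ := exists_norm_sub_le_of_contDiffOn hopen
    (hsmooth.of_le (by norm_cast)) hDc hDconv hRsub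
  obtain ⟨K, hK, hTay⟩ := exists_taylor_bound_of_contDiffOn hopen
    (hsmooth.of_le (by norm_cast)) hDc hDconv hRsub
  set A := 2 * L ^ 2 / c ^ 2 + K / c + 1 with hA
  have hA0 : 0 < A := by positivity
  -- `r / 2` keeps the geodesic and any shorter competitor inside the chart ball; the square root is
  -- the smallness condition `hshort`.
  refine ⟨min (r / 2) (√(c / (8 * A))), by positivity, fun γ hγ a b hap hab hba => ?_⟩
  by_contra! hlt
  have hba1 : b - a < r / 2 := hba.trans_le (min_le_left _ _)
  have hap1 : dist (γ a) p < r / 2 := hap.trans_le (min_le_left _ _)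
  have hshort : 8 * A * (b - a) ^ 2 ≤ c := by
    have h1 : b - a ≤ √(c / (8 * A)) := (hba.trans_le (min_le_right _ _)).le
    have h2 : (b - a) ^ 2 ≤ c / (8 * A) := by
      have := pow_le_pow_left₀ (by linarith) h1 2
      rwa [Real.sq_sqrt (by positivity)] at this
    calc 8 * A * (b - a) ^ 2 ≤ 8 * A * (c / (8 * A)) := by gcongr
      _ = c := by field_simp
  have hed : Manifold.riemannianEDist (𝓡 m) (γ a) (γ b) < ENNReal.ofReal (b - a) := by
    rw [← IsRiemannianManifold.out (I := 𝓡 m) (γ a) (γ b), edist_dist]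
    exact (ENNReal.ofReal_lt_ofReal_iff_of_nonneg dist_nonneg).2 hlt
  obtain ⟨σ, hσ0, hσ1, hσ, hσlen, -, -⟩ :=
    Manifold.exists_lt_locally_constant_of_riemannianEDist_lt hed zero_lt_one
  have hwcont := continuous_norm_velocity (m := m) hσ
  set W : ℝ → ℝ := fun t => ∫ x in (0 : ℝ)..t, ‖velocity m σ x‖ with hWdef
  have hW' : ∀ t, HasDerivAt W ‖velocity m σ t‖ t := fun t =>
    intervalIntegral.integral_hasDerivAt_right (hwcont.intervalIntegrable _ _)
      hwcont.stronglyMeasurable.stronglyMeasurableAtFilter hwcont.continuousAt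
  have hlen : ∀ t, 0 ≤ t → Manifold.pathELength (𝓡 m) σ 0 t = ENNReal.ofReal (W t) := by
    intro t ht
    rw [pathELength_eq_lintegral_norm_velocity, hWdef]
    simp only
    rw [intervalIntegral.integral_of_le ht, MeasureTheory.ofReal_integral_eq_lintegral_ofReal,
      MeasureTheory.restrict_Ioc_eq_restrict_Icc]
    · exact (hwcont.intervalIntegrable 0 t).1
    · exact Eventually.of_forall fun _ => norm_nonneg _
  have hWlt : W 1 < b - a := by
    rw [hlen 1 zero_le_one] at hσlen
    exact (ENNReal.ofReal_lt_ofReal_iff_of_nonneg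
      (intervalIntegral.integral_nonneg zero_le_one fun _ _ => norm_nonneg _)).1 hσlen
  have hWmono : Monotone W := monotone_of_deriv_nonneg (fun t => (hW' t).differentiableAt)
    (fun t => by rw [(hW' t).deriv]; exact norm_nonneg _)
  have hW0 : W 0 = 0 := by simp [hWdef]
  -- A curve from `γ a` of length below `r / 2` cannot leave the ball of radius `r`.
  have hσball : ∀ t ∈ Icc (0 : ℝ) 1, dist (σ t) p < r := by
    intro t ht
    have h1 : edist (σ 0) (σ t) ≤ ENNReal.ofReal (W t) := by
      rw [IsRiemannianManifold.out (I := 𝓡 m) (σ 0) (σ t), ← hlen t ht.1]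
      exact Manifold.riemannianEDist_le_pathELength hσ.contMDiffOn rfl rfl ht.1
    have hWt : 0 ≤ W t := hW0 ▸ hWmono ht.1
    have h2 : dist (σ 0) (σ t) ≤ W t := by
      rw [dist_edist]
      exact ENNReal.toReal_le_of_le_ofReal hWt h1
    have h3 : W t ≤ W 1 := hWmono ht.2
    have h4 := dist_triangle (σ t) (γ a) p
    rw [dist_comm (σ t) (γ a)] at h4
    rw [hσ0] at h2
    linarith
  have hγball : ∀ t ∈ Icc a b, dist (γ t) p < r := by
    intro t ht
    have h1 := hγ.dist_le t a
    rw [abs_of_nonneg (sub_nonneg.2 ht.1)] at h1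
    have h2 := dist_triangle (γ t) (γ a) p
    linarith [ht.2]
  have hfinal := geodesic_length_le (g := metricForm (m := m) p) (D := D) (a := a) (b := b)
    (z := phaseCoord p γ) (s := fun t => extChartAt (𝓡 m) p (σ t))
    (s' := fun t => (phaseCoord p σ t).2) (W := W) (w := fun t => ‖velocity m σ t‖)
    hc hK (le_add_of_nonneg_right zero_le_one : _ ≤ A) hA0
    (fun u _ => metricForm_symm p u) hcoer (fun u hu => differentiableAt_metricForm p (hRsub hu))
    (fun u hu => isInvertible_metricForm p (hRsub hu)) hLip hTay hshort
    (fun t ht => hγ.1.hasDerivAt_phaseCoord (hball _ (hγball t ht)).1)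
    (fun t ht => (hball _ (hγball t ht)).2)
    (fun t ht => by
      rw [← norm_sq_velocity (hγ.1.mdifferentiableAt t) (hball _ (hγball t ht)).1, hγ.2 t, one_pow])
    (fun t ht => (contDiffAt_extChartAt_comp (by norm_cast) (hσ t)
      (hball _ (hσball t ht)).1).continuousAt.continuousWithinAt)
    (fun t ht => (hball _ (hσball t ht)).2)
    (fun t ht => ((contDiffAt_extChartAt_comp (by norm_cast) (hσ t)
      (hball _ (hσball t (Ioo_subset_Icc_self ht))).1).differentiableAt (by simp)).hasDerivAt)
    (by simp only [hσ0]; rfl) (by simp only [hσ1]; rfl)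
    (fun t _ => (hW' t).continuousAt.continuousWithinAt) (fun t _ => hW' t) hW0
    (fun t _ => norm_nonneg _)
    (fun t ht => norm_sq_velocity ((hσ t).mdifferentiableAt (by simp))
      (hball _ (hσball t (Ioo_subset_Icc_self ht))).1)
  linarith

end RiemannianDistance

/-! ### Strict differentiability of ODE solutions in a parameter. -/

noncomputable section FlowDifferentiability

variable {V F : Type*} [NormedAddCommGroup V] [NormedSpace ℝ V]
  [NormedAddCommGroup F] [NormedSpace ℝ F]

lemma gronwallBound_le_add_mul_exp {δ K η x : ℝ} (hK : 1 ≤ K) (hη : 0 ≤ η) :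
    gronwallBound δ K η x ≤ (δ + η) * Real.exp (K * x) := by
  rw [gronwallBound_of_K_ne_0 (by linarith)]
  have h1 : η / K ≤ η := div_le_self hη hK
  have h0 : 0 ≤ η / K := by positivity
  have h2 : 0 < Real.exp (K * x) := Real.exp_pos _
  nlinarith

lemma norm_sub_le_exp_of_ode_forward {f : F → F} {D : Set F} {K : NNReal}
    (hf : LipschitzOnWith K f D) {t s : ℝ} (hts : t ≤ s) {x y : ℝ → F}
    (hx : ∀ r ∈ Icc t s, HasDerivAt x (f (x r)) r ∧ x r ∈ D)
    (hy : ∀ r ∈ Icc t s, HasDerivAt y (f (y r)) r ∧ y r ∈ D) :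
    ‖x s - y s‖ ≤ ‖x t - y t‖ * Real.exp (K * (s - t)) := by
  have h := dist_le_of_trajectories_ODE_of_mem (v := fun _ => f) (s := fun _ => D) (K := K)
    (f := x) (g := y) (a := t) (b := s) (fun _ _ => hf)
    (fun r hr => (hx r hr).1.continuousAt.continuousWithinAt)
    (fun r hr => (hx r (Ico_subset_Icc_self hr)).1.hasDerivWithinAt)
    (fun r hr => (hx r (Ico_subset_Icc_self hr)).2)
    (fun r hr => (hy r hr).1.continuousAt.continuousWithinAt)
    (fun r hr => (hy r (Ico_subset_Icc_self hr)).1.hasDerivWithinAt)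
    (fun r hr => (hy r (Ico_subset_Icc_self hr)).2) le_rfl s (right_mem_Icc.2 hts)
  rwa [dist_eq_norm, dist_eq_norm] at h

lemma reversed_ode {f : F → F} {D : Set F} {t s : ℝ} {x : ℝ → F}
    (hx : ∀ r ∈ Icc s t, HasDerivAt x (f (x r)) r ∧ x r ∈ D) :
    ∀ r ∈ Icc (-t) (-s), HasDerivAt (fun r => x (-r)) (-f (x (-r))) r ∧ x (-r) ∈ D := by
  intro r hr
  have hr' : -r ∈ Icc s t := ⟨by linarith [hr.2], by linarith [hr.1]⟩
  refine ⟨?_, (hx _ hr').2⟩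
  exact ((hx _ hr').1.scomp r (hasDerivAt_neg r)).congr_deriv (by simp)

lemma norm_sub_le_exp_of_ode {f : F → F} {D : Set F} {K : NNReal}
    (hf : LipschitzOnWith K f D) {t s : ℝ} {x y : ℝ → F}
    (hx : ∀ r ∈ uIcc t s, HasDerivAt x (f (x r)) r ∧ x r ∈ D)
    (hy : ∀ r ∈ uIcc t s, HasDerivAt y (f (y r)) r ∧ y r ∈ D) :
    ‖x s - y s‖ ≤ ‖x t - y t‖ * Real.exp (K * |s - t|) := by
  rcases le_total t s with h | h
  · rw [uIcc_of_le h] at hx hy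
    rw [abs_of_nonneg (sub_nonneg.2 h)]
    exact norm_sub_le_exp_of_ode_forward hf h hx hy
  · rw [uIcc_of_ge h] at hx hy
    rw [abs_of_nonpos (sub_nonpos.2 h)]
    have := norm_sub_le_exp_of_ode_forward (f := fun x => -f x) (D := D) (K := K) hf.neg
      (neg_le_neg h) (reversed_ode hx) (reversed_ode hy)
    simp only [neg_neg] at this
    rwa [show -(s - t) = -s - -t by ring]

variable [CompleteSpace F]

lemma exists_linear_ode_solution {B : ℝ → F →L[ℝ] F} {K t s : ℝ} (hts : t ≤ s)
    (hB : ContinuousOn B (Icc t s)) (hBK : ∀ r ∈ Icc t s, ‖B r‖ ≤ K)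
    (hsmall : 2 * K * (s - t) ≤ 1) (A : V →L[ℝ] F) :
    ∃ X : ℝ → V →L[ℝ] F, X t = A ∧
      ∀ r ∈ Icc t s, HasDerivWithinAt X ((B r).comp (X r)) (Icc t s) r := by
  have hK0 : 0 ≤ K := (norm_nonneg _).trans (hBK t (left_mem_Icc.2 hts))
  -- On the ball of radius `‖A‖ + 1` about `A` the field is bounded by `K * (2 * ‖A‖ + 1)`, and
  -- `hsmall` lets the solution last for the whole interval.
  have hPL : IsPicardLindelof (fun r (X : V →L[ℝ] F) => (B r).comp X)
      (⟨t, left_mem_Icc.2 hts⟩ : Icc t s) A (‖A‖₊ + 1) 0 (K.toNNReal * (2 * ‖A‖₊ + 1))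
      K.toNNReal := by
    refine ⟨fun r hr => ?_, fun X _ => ?_, fun r hr X hX => ?_, ?_⟩
    · refine LipschitzWith.lipschitzOnWith (LipschitzWith.of_dist_le_mul fun X Y => ?_)
      rw [dist_eq_norm, dist_eq_norm, Real.coe_toNNReal K hK0, ← ContinuousLinearMap.comp_sub]
      exact (ContinuousLinearMap.opNorm_comp_le _ _).trans
        (mul_le_mul_of_nonneg_right (hBK r hr) (norm_nonneg _))
    · exact hB.clm_comp continuousOn_const
    · have h1 : ‖X‖ ≤ 2 * ‖A‖ + 1 := by
        have := mem_closedBall_iff_norm.1 hX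
        simp only [NNReal.coe_add, coe_nnnorm, NNReal.coe_one] at this
        linarith [norm_le_norm_add_norm_sub A X, norm_sub_rev X A]
      simp only [NNReal.coe_mul, Real.coe_toNNReal K hK0, NNReal.coe_add, coe_nnnorm,
        NNReal.coe_one, NNReal.coe_ofNat]
      exact (ContinuousLinearMap.opNorm_comp_le _ _).trans
        (mul_le_mul (hBK r hr) h1 (norm_nonneg _) hK0)
    · simp only [NNReal.coe_mul, Real.coe_toNNReal K hK0, NNReal.coe_add, coe_nnnorm,
        NNReal.coe_one, NNReal.coe_ofNat, sub_self, NNReal.coe_zero, sub_zero]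
      rw [max_eq_left (by linarith)]
      have := mul_le_mul_of_nonneg_left hsmall (by positivity : 0 ≤ 2 * ‖A‖ + 1)
      nlinarith [norm_nonneg A]
  obtain ⟨X, hX0, hX⟩ := hPL.exists_eq_forall_mem_Icc_hasDerivWithinAt₀
  exact ⟨X, hX0, hX⟩

/-- The derivative is the solution `X` of the linearised equation along `z v₀` with `X t = A`.
Grönwall is applied to `z p.1 - z p.2 - X (p.1 - p.2)`, whose forcing term is `‖p.1 - p.2‖` times a
factor tending to zero. Both points move because the inverse function theorem needs strict
differentiability. -/
lemma HasStrictFDerivAt.exists_ode_flow_forward {f : F → F} {B : F → F →L[ℝ] F} {D : Set F}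
    {K K₂ : ℝ} (hD : Convex ℝ D) (hK : 1 ≤ K) (hK₂ : 0 ≤ K₂)
    (hf : ∀ x ∈ D, HasFDerivAt f (B x) x) (hB : ∀ x ∈ D, ‖B x‖ ≤ K)
    (hB₂ : ∀ x ∈ D, ∀ y ∈ D, ‖B y - B x‖ ≤ K₂ * ‖y - x‖) {t s : ℝ} (hts : t ≤ s)
    (hsmall : 2 * K * (s - t) ≤ 1) {z : V → ℝ → F} {v₀ : V}
    (hz : ∀ᶠ v in 𝓝 v₀, ∀ r ∈ Icc t s, HasDerivAt (z v) (f (z v r)) r ∧ z v r ∈ D)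
    {A : V →L[ℝ] F} (hA : HasStrictFDerivAt (fun v => z v t) A v₀) :
    ∃ A' : V →L[ℝ] F, HasStrictFDerivAt (fun v => z v s) A' v₀ := by
  have hz₀ := hz.self_of_nhds
  have hK0 : 0 ≤ K := by linarith
  have hz₀c : ContinuousOn (z v₀) (Icc t s) :=
    fun r hr => (hz₀ r hr).1.continuousAt.continuousWithinAt
  have hBc : ContinuousOn B D := by
    have : LipschitzOnWith K₂.toNNReal B D := by
      refine LipschitzOnWith.of_dist_le_mul fun x hx y hy => ?_
      rw [dist_eq_norm, dist_eq_norm, Real.coe_toNNReal K₂ hK₂]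
      exact hB₂ y hy x hx
    exact this.continuousOn
  obtain ⟨X, hX0, hX⟩ := exists_linear_ode_solution hts
    (hBc.comp hz₀c fun r hr => (hz₀ r hr).2) (fun r hr => hB _ (hz₀ r hr).2) hsmall A
  have hfLip : LipschitzOnWith K.toNNReal f D := by
    refine hD.lipschitzOnWith_of_nnnorm_hasFDerivWithin_le
      (fun x hx => (hf x hx).hasFDerivWithinAt) (fun x hx => ?_)
    rw [← NNReal.coe_le_coe, coe_nnnorm, Real.coe_toNNReal K hK0]
    exact hB x hx
  obtain ⟨C, N, hN, hC⟩ := hA.exists_lipschitzOnWith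
  set G := Real.exp (K * (s - t)) with hG
  have hG1 : 1 ≤ G := Real.one_le_exp (mul_nonneg hK0 (sub_nonneg.2 hts))
  have hgood : ∀ᶠ v in 𝓝 v₀, v ∈ N ∧
      ∀ r ∈ Icc t s, HasDerivAt (z v) (f (z v r)) r ∧ z v r ∈ D := (Filter.eventually_mem_set.2 hN).and hz
  have hdist : ∀ v ∈ N, (∀ r ∈ Icc t s, HasDerivAt (z v) (f (z v r)) r ∧ z v r ∈ D) →
      ∀ v' ∈ N, (∀ r ∈ Icc t s, HasDerivAt (z v') (f (z v' r)) r ∧ z v' r ∈ D) →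
      ∀ r ∈ Icc t s, ‖z v r - z v' r‖ ≤ C * G * ‖v - v'‖ := by
    intro v hv hzv v' hv' hzv' r hr
    have h1 := norm_sub_le_exp_of_ode_forward hfLip hr.1
      (fun q hq => hzv q ⟨hq.1, hq.2.trans hr.2⟩) (fun q hq => hzv' q ⟨hq.1, hq.2.trans hr.2⟩)
    have h2 : ‖z v t - z v' t‖ ≤ C * ‖v - v'‖ := by
      have := hC.dist_le_mul v hv v' hv'
      rwa [dist_eq_norm, dist_eq_norm] at this
    have h3 : Real.exp (K.toNNReal * (r - t)) ≤ G := by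
      rw [Real.coe_toNNReal K hK0, hG]
      exact Real.exp_le_exp.2 (by gcongr; exact hr.2)
    calc ‖z v r - z v' r‖ ≤ ‖z v t - z v' t‖ * Real.exp (K.toNNReal * (r - t)) := h1
      _ ≤ (C * ‖v - v'‖) * G := by gcongr
      _ = C * G * ‖v - v'‖ := by ring
  refine ⟨X s, ?_⟩
  rw [hasStrictFDerivAt_iff_isLittleO] at hA ⊢
  have hO : (fun p : V × V => z p.1 s - z p.2 s - X s (p.1 - p.2)) =O[𝓝 (v₀, v₀)]
      fun p : V × V => ‖z p.1 t - z p.2 t - A (p.1 - p.2)‖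
        + K₂ * (C * G) ^ 2 * (‖p.1 - v₀‖ + ‖p.2 - v₀‖) * ‖p.1 - p.2‖ := by
    refine Asymptotics.IsBigO.of_bound G ?_
    rw [nhds_prod_eq]
    filter_upwards [hgood.prod_mk hgood] with p hp
    obtain ⟨⟨hp1, hz1⟩, hp2, hz2⟩ := hp
    have hv0N : v₀ ∈ N := mem_of_mem_nhds hN
    set η := K₂ * (C * G) ^ 2 * (‖p.1 - v₀‖ + ‖p.2 - v₀‖) * ‖p.1 - p.2‖ with hη
    have hη0 : 0 ≤ η := by positivity
    have hmain := norm_le_gronwallBound_of_norm_deriv_right_le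
      (f := fun r => z p.1 r - z p.2 r - X r (p.1 - p.2))
      (f' := fun r => f (z p.1 r) - f (z p.2 r) - (B (z v₀ r)) (X r (p.1 - p.2)))
      (δ := ‖z p.1 t - z p.2 t - A (p.1 - p.2)‖) (K := K) (ε := η) (a := t) (b := s) ?_ ?_ ?_ ?_
      s (right_mem_Icc.2 hts)
    · rw [Real.norm_of_nonneg (by positivity : (0:ℝ) ≤ ‖z p.1 t - z p.2 t - A (p.1 - p.2)‖ + η),
        mul_comm]
      exact hmain.trans (gronwallBound_le_add_mul_exp hK hη0)
    · intro r hr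
      exact (((hz1 r hr).1.continuousAt.sub (hz2 r hr).1.continuousAt).continuousWithinAt).sub
        ((hX r hr).continuousWithinAt.clm_apply continuousWithinAt_const)
    · intro r hr
      have hr' := Ico_subset_Icc_self hr
      have hXr : HasDerivWithinAt X ((B (z v₀ r)).comp (X r)) (Ici r) r :=
        (hX r hr').mono_of_mem_nhdsWithin (Icc_mem_nhdsGE_of_mem hr)
      have hXv := hXr.clm_apply (hasDerivWithinAt_const r (Ici r) (p.1 - p.2))
      refine (((hz1 r hr').1.sub (hz2 r hr').1).hasDerivWithinAt.sub hXv).congr_deriv ?_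
      simp
    · simp only [hX0]
      exact le_rfl
    · intro r hr
      have hr' := Ico_subset_Icc_self hr
      have h0D := (hz₀ r hr').2
      have hd1 := hdist _ hp1 hz1 _ hv0N hz₀ r hr'
      have hd2 := hdist _ hp2 hz2 _ hv0N hz₀ r hr'
      have hd3 := hdist _ hp1 hz1 _ hp2 hz2 r hr'
      have hseg : segment ℝ (z p.2 r) (z p.1 r) ⊆ D :=
        hD.segment_subset (hz2 r hr').2 (hz1 r hr').2
      -- The segment joining the two solutions stays close to `z v₀ r`, so `B` on it is close to `B
      -- (z v₀ r)`.
      have hbr : ‖f (z p.1 r) - f (z p.2 r) - B (z v₀ r) (z p.1 r - z p.2 r)‖ ≤ η := by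
        have h1 := (convex_segment (𝕜 := ℝ) (z p.2 r) (z p.1 r)
          ).norm_image_sub_le_of_norm_hasFDerivWithin_le'
          (f := f) (f' := B) (φ := B (z v₀ r))
          (C := K₂ * (C * G * (‖p.1 - v₀‖ + ‖p.2 - v₀‖)))
          (fun x hx => (hf x (hseg hx)).hasFDerivWithinAt)
          (fun x hx => (hB₂ _ h0D _ (hseg hx)).trans ?_)
          (left_mem_segment ℝ _ _) (right_mem_segment ℝ _ _)
        · refine h1.trans ?_
          calc K₂ * (C * G * (‖p.1 - v₀‖ + ‖p.2 - v₀‖)) * ‖z p.1 r - z p.2 r‖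
              ≤ K₂ * (C * G * (‖p.1 - v₀‖ + ‖p.2 - v₀‖)) * (C * G * ‖p.1 - p.2‖) := by gcongr
            _ = η := by rw [hη]; ring
        · have hball : Convex ℝ (Metric.closedBall (z v₀ r)
              (C * G * (‖p.1 - v₀‖ + ‖p.2 - v₀‖))) := convex_closedBall _ _
          have hmem := hball.segment_subset (x := z p.2 r) (y := z p.1 r)
            (mem_closedBall_iff_norm.2 (hd2.trans (by
              gcongr; exact le_add_of_nonneg_left (norm_nonneg _))))
            (mem_closedBall_iff_norm.2 (hd1.trans (by
              gcongr; exact le_add_of_nonneg_right (norm_nonneg _)))) hx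
          gcongr
          exact mem_closedBall_iff_norm.1 hmem
      have hsplit : f (z p.1 r) - f (z p.2 r) - (B (z v₀ r)) (X r (p.1 - p.2))
          = (f (z p.1 r) - f (z p.2 r) - B (z v₀ r) (z p.1 r - z p.2 r))
            + B (z v₀ r) (z p.1 r - z p.2 r - X r (p.1 - p.2)) := by
        rw [map_sub (B (z v₀ r)) (z p.1 r - z p.2 r)]
        abel
      rw [hsplit]
      refine (norm_add_le _ _).trans ?_
      have := (B (z v₀ r)).le_of_opNorm_le (hB _ h0D) (z p.1 r - z p.2 r - X r (p.1 - p.2))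
      linarith
  refine hO.trans_isLittleO ((hA.norm_left).add ?_)
  have hto : Tendsto (fun p : V × V => K₂ * (C * G) ^ 2 * (‖p.1 - v₀‖ + ‖p.2 - v₀‖))
      (𝓝 (v₀, v₀)) (𝓝 0) := by
    have hc : Continuous (fun p : V × V => K₂ * (C * G) ^ 2 * (‖p.1 - v₀‖ + ‖p.2 - v₀‖)) := by
      fun_prop
    have := hc.tendsto (v₀, v₀)
    simpa using this
  have h1 := ((Asymptotics.isLittleO_one_iff ℝ).2 hto).mul_isBigO
    (Asymptotics.isBigO_refl (fun p : V × V => ‖p.1 - p.2‖) (𝓝 (v₀, v₀)))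
  simp only [one_mul] at h1
  exact h1.of_norm_right

lemma HasStrictFDerivAt.exists_ode_flow {f : F → F} {B : F → F →L[ℝ] F} {D : Set F}
    {K K₂ : ℝ} (hD : Convex ℝ D) (hK : 1 ≤ K) (hK₂ : 0 ≤ K₂)
    (hf : ∀ x ∈ D, HasFDerivAt f (B x) x) (hB : ∀ x ∈ D, ‖B x‖ ≤ K)
    (hB₂ : ∀ x ∈ D, ∀ y ∈ D, ‖B y - B x‖ ≤ K₂ * ‖y - x‖) {t s : ℝ}
    (hsmall : 2 * K * |s - t| ≤ 1) {z : V → ℝ → F} {v₀ : V}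
    (hz : ∀ᶠ v in 𝓝 v₀, ∀ r ∈ uIcc t s, HasDerivAt (z v) (f (z v r)) r ∧ z v r ∈ D)
    {A : V →L[ℝ] F} (hA : HasStrictFDerivAt (fun v => z v t) A v₀) :
    ∃ A' : V →L[ℝ] F, HasStrictFDerivAt (fun v => z v s) A' v₀ := by
  rcases le_total t s with h | h
  · rw [uIcc_of_le h] at hz
    rw [abs_of_nonneg (sub_nonneg.2 h)] at hsmall
    exact HasStrictFDerivAt.exists_ode_flow_forward hD hK hK₂ hf hB hB₂ h hsmall hz hA
  · rw [uIcc_of_ge h] at hz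
    rw [abs_of_nonpos (sub_nonpos.2 h)] at hsmall
    have := HasStrictFDerivAt.exists_ode_flow_forward (f := fun x => -f x) (B := fun x => -B x)
      (z := fun v r => z v (-r)) (t := -t) (s := -s) (A := A) (v₀ := v₀) hD hK hK₂
      (fun x hx => (hf x hx).neg) (fun x hx => by rw [norm_neg]; exact hB x hx)
      (fun x hx y hy => by
        rw [← neg_sub', norm_neg]
        exact hB₂ x hx y hy) (neg_le_neg h) (by rwa [show -s - -t = -(s - t) by ring])
      (hz.mono fun v hv => reversed_ode hv) (by simpa using hA)
    simpa using this

end FlowDifferentiability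

/-! ### Continuous and differentiable dependence carried from chart to chart. -/

noncomputable section GeodesicPropagation

variable {m : ℕ} {M : Type*}

local notation "𝔼" => EuclideanSpace ℝ (Fin m)

/-- Such a property is locally constant in time and `ℝ` is connected, so chart-sized time steps are
enough. -/
lemma forall_of_locally_constant {P : ℝ → Prop}
    (h : ∀ t₀, ∃ δ > 0, ∀ t s, |t - t₀| < δ → |s - t₀| < δ → P t → P s) {t : ℝ} (ht : P t) (s : ℝ) :
    P s := by
  have hloc : IsLocallyConstant P := by
    rw [IsLocallyConstant.iff_eventually_eq]
    intro t₀
    obtain ⟨δ, hδ, hP⟩ := h t₀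
    filter_upwards [Metric.ball_mem_nhds t₀ hδ] with t ht
    rw [Metric.mem_ball, Real.dist_eq] at ht
    have h0 : |t₀ - t₀| < δ := by simpa using hδ
    exact propext ⟨hP t t₀ ht h0, hP t₀ t h0 ht⟩
  exact hloc.apply_eq_of_preconnectedSpace t s ▸ ht

section Transition

variable [TopologicalSpace M] [ChartedSpace (EuclideanSpace ℝ (Fin m)) M]

/-- The change of phase space coordinates from the chart at `p` to the chart at `q`. -/
def phaseTransition (p q : M) (z : 𝔼 × 𝔼) : 𝔼 × 𝔼 :=
  (extChartAt (𝓡 m) q ((extChartAt (𝓡 m) p).symm z.1),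
    fderiv ℝ (extChartAt (𝓡 m) q ∘ (extChartAt (𝓡 m) p).symm) z.1 z.2)

variable [IsManifold (𝓡 m) ∞ M]

lemma contDiffAt_transition {p q x : M} (hp : x ∈ (extChartAt (𝓡 m) p).source)
    (hq : x ∈ (extChartAt (𝓡 m) q).source) :
    ContDiffAt ℝ ∞ (extChartAt (𝓡 m) q ∘ (extChartAt (𝓡 m) p).symm) (extChartAt (𝓡 m) p x) := by
  have h := contDiffWithinAt_ext_coord_change (I := 𝓡 m) (n := ∞) q p
    (y := extChartAt (𝓡 m) p x) (by
      rw [PartialEquiv.trans_source, PartialEquiv.symm_source]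
      exact ⟨(extChartAt (𝓡 m) p).map_source hp, by
        rw [mem_preimage, (extChartAt (𝓡 m) p).left_inv hp]
        exact hq⟩)
  rwa [ModelWithCorners.range_eq_univ, contDiffWithinAt_univ] at h

lemma contDiffAt_phaseTransition {p q x : M} (hp : x ∈ (extChartAt (𝓡 m) p).source)
    (hq : x ∈ (extChartAt (𝓡 m) q).source) (a : 𝔼) :
    ContDiffAt ℝ 1 (phaseTransition (m := m) p q) (extChartAt (𝓡 m) p x, a) := by
  have h := contDiffAt_transition hp hq
  have h1 : ContDiffAt ℝ 1 (fun z : 𝔼 × 𝔼 =>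
      (extChartAt (𝓡 m) q ∘ (extChartAt (𝓡 m) p).symm) z.1) (extChartAt (𝓡 m) p x, a) :=
    ContDiffAt.comp (x := (extChartAt (𝓡 m) p x, a)) (f := Prod.fst)
      (h.of_le (by norm_cast)) contDiffAt_fst
  have h2 : ContDiffAt ℝ 1 (fun z : 𝔼 × 𝔼 =>
      fderiv ℝ (extChartAt (𝓡 m) q ∘ (extChartAt (𝓡 m) p).symm) z.1)
      (extChartAt (𝓡 m) p x, a) :=
    ContDiffAt.comp (x := (extChartAt (𝓡 m) p x, a)) (f := Prod.fst)
      (h.fderiv_right (m := 1) (by norm_cast)) contDiffAt_fst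
  exact h1.prodMk (h2.clm_apply contDiffAt_snd)

lemma phaseTransition_phaseCoord {p q : M} {γ : ℝ → M} {t : ℝ}
    (hγ : ContMDiffAt 𝓘(ℝ, ℝ) (𝓡 m) 1 γ t) (hp : γ t ∈ (extChartAt (𝓡 m) p).source)
    (hq : γ t ∈ (extChartAt (𝓡 m) q).source) :
    phaseTransition p q (phaseCoord p γ t) = phaseCoord (m := m) q γ t := by
  have hc := ((contDiffAt_extChartAt_comp (by norm_cast) hγ hp).differentiableAt
    (by simp)).hasDerivAt
  have hτ := ((contDiffAt_transition hp hq).differentiableAt (by simp)).hasFDerivAt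
  have hcomp := HasFDerivAt.comp_hasDerivAt t (f := fun s => extChartAt (𝓡 m) p (γ s)) hτ hc
  have hev : (fun s => extChartAt (𝓡 m) q (γ s)) =ᶠ[𝓝 t]
      ((extChartAt (𝓡 m) q ∘ (extChartAt (𝓡 m) p).symm) ∘ fun s => extChartAt (𝓡 m) p (γ s)) := by
    filter_upwards [hγ.continuousAt.preimage_mem_nhds
      ((isOpen_extChartAt_source (I := 𝓡 m) p).mem_nhds hp)] with s hs
    simp only [Function.comp_apply]
    rw [(extChartAt (𝓡 m) p).left_inv hs]
  refine Prod.ext ?_ ?_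
  · simp only [phaseTransition, phaseCoord]
    rw [(extChartAt (𝓡 m) p).left_inv hp]
  · exact (hcomp.congr_of_eventuallyEq hev).deriv.symm

end Transition

variable [MetricSpace M] [ChartedSpace (EuclideanSpace ℝ (Fin m)) M]
  [RiemannianBundle (fun x : M => TangentSpace (𝓡 m) x)]

lemma IsUnitGeodesic.contMDiffAt {γ : ℝ → M} (hγ : IsUnitGeodesic m γ) (t : ℝ) :
    ContMDiffAt 𝓘(ℝ, ℝ) (𝓡 m) 1 γ t :=
  (hγ.1.1 t).of_le (by norm_cast)

variable [IsManifold (𝓡 m) ∞ M]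
  [IsContMDiffRiemannianBundle (𝓡 m) ∞ (EuclideanSpace ℝ (Fin m))
      (fun x : M => TangentSpace (𝓡 m) x)]

/-- Near `p`, the phase space coordinates of unit speed geodesics stay in a convex set on which
the geodesic field has bounded first and second derivatives. -/
lemma exists_phase_domain (p : M) :
    ∃ r > 0, ∃ D : Set (𝔼 × 𝔼), Convex ℝ D ∧ ∃ K K₂ : ℝ, 1 ≤ K ∧ 0 ≤ K₂ ∧
      (∀ z ∈ D, HasFDerivAt (geodesicField (metricForm (m := m) p))
        (fderiv ℝ (geodesicField (metricForm (m := m) p)) z) z) ∧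
      (∀ z ∈ D, ‖fderiv ℝ (geodesicField (metricForm (m := m) p)) z‖ ≤ K) ∧
      (∀ z ∈ D, ∀ z' ∈ D, ‖fderiv ℝ (geodesicField (metricForm (m := m) p)) z'
        - fderiv ℝ (geodesicField (metricForm (m := m) p)) z‖ ≤ K₂ * ‖z' - z‖) ∧
      ∀ γ : ℝ → M, IsUnitGeodesic m γ → ∀ t, dist (γ t) p < r →
        γ t ∈ (extChartAt (𝓡 m) p).source ∧
        HasDerivAt (phaseCoord (m := m) p γ)
          (geodesicField (metricForm p) (phaseCoord p γ t)) t ∧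
        phaseCoord p γ t ∈ D := by
  obtain ⟨r, hr, R, hR, hRsub, hball⟩ := exists_ball_subset_chart (m := m) p
  set D₁ := Metric.closedBall (extChartAt (𝓡 m) p p) R with hD₁
  obtain ⟨c, hc, hcoer⟩ := exists_coercive_of_pos (isCompact_closedBall _ _ : IsCompact D₁)
    ((contDiffOn_metricForm (m := m) p).continuousOn.mono hRsub)
    (fun u hu a ha => metricForm_pos p (hRsub hu) ha)
  set D : Set (𝔼 × 𝔼) := D₁ ×ˢ Metric.closedBall 0 (√(1 / c)) with hD
  have hDc : IsCompact D := (isCompact_closedBall _ _).prod (isCompact_closedBall _ _)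
  have hDconv : Convex ℝ D := (convex_closedBall _ _).prod (convex_closedBall _ _)
  have hopen : IsOpen ((extChartAt (𝓡 m) p).target ×ˢ (univ : Set 𝔼)) :=
    (isOpen_extChartAt_target (I := 𝓡 m) p).prod isOpen_univ
  have hDsub : D ⊆ (extChartAt (𝓡 m) p).target ×ˢ (univ : Set 𝔼) :=
    fun z hz => ⟨hRsub hz.1, mem_univ _⟩
  have hsm := contDiffOn_geodesicField_metricForm (m := m) p
  have hder : ContDiffOn ℝ 1 (fderiv ℝ (geodesicField (metricForm (m := m) p)))
      ((extChartAt (𝓡 m) p).target ×ˢ (univ : Set 𝔼)) :=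
    hsm.fderiv_of_isOpen hopen (by norm_cast)
  obtain ⟨K, hK⟩ := hDc.exists_bound_of_continuousOn (hder.continuousOn.mono hDsub)
  obtain ⟨K₂, hK₂0, hK₂⟩ := exists_norm_sub_le_of_contDiffOn hopen hder hDc hDconv hDsub
  refine ⟨r, hr, D, hDconv, max K 1, K₂, le_max_right _ _, hK₂0, fun z hz => ?_,
    fun z hz => (hK z hz).trans (le_max_left _ _), hK₂, fun γ hγ t ht => ?_⟩
  · exact ((hsm.contDiffAt (hopen.mem_nhds (hDsub hz))).differentiableAt (by simp)).hasFDerivAt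
  · obtain ⟨hsrc, hmem⟩ := hball _ ht
    refine ⟨hsrc, hγ.1.hasDerivAt_phaseCoord hsrc, hmem, ?_⟩
    rw [mem_closedBall_zero_iff]
    apply Real.le_sqrt_of_sq_le
    rw [le_div_iff₀ hc, mul_comm]
    refine (hcoer _ hmem _).trans_eq ?_
    have := norm_sq_velocity (hγ.1.mdifferentiableAt t) hsrc
    rw [hγ.2 t, one_pow] at this
    exact this.symm

variable [IsRiemannianManifold (𝓡 m) M]

/-- The phase space coordinates of a family of curves converge to those of a limit curve. -/
def PhaseTendsto {ι : Type*} (l : Filter ι) (γ : ι → ℝ → M) (γ₀ : ℝ → M) (t : ℝ) : Prop :=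
  Tendsto (fun i => γ i t) l (𝓝 (γ₀ t)) ∧ ∃ p : M, γ₀ t ∈ (extChartAt (𝓡 m) p).source ∧
    Tendsto (fun i => phaseCoord (m := m) p (γ i) t) l (𝓝 (phaseCoord p γ₀ t))

-- The phase transition map is continuous, so the chart witnessing convergence can be exchanged for
-- any other one around the limit point.
omit [IsRiemannianManifold (𝓡 m) M] [IsContMDiffRiemannianBundle (𝓡 m) ∞ (EuclideanSpace ℝ (Fin m))
      (fun x : M => TangentSpace (𝓡 m) x)] in
lemma PhaseTendsto.in_chart {ι : Type*} {l : Filter ι} {γ : ι → ℝ → M} {γ₀ : ℝ → M} {t : ℝ}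
    (hγ : ∀ i, IsUnitGeodesic m (γ i)) (hγ₀ : IsUnitGeodesic m γ₀)
    (h : PhaseTendsto (m := m) l γ γ₀ t) {p : M} (hp : γ₀ t ∈ (extChartAt (𝓡 m) p).source) :
    Tendsto (fun i => phaseCoord (m := m) p (γ i) t) l (𝓝 (phaseCoord p γ₀ t)) := by
  obtain ⟨h1, q, hq, h2⟩ := h
  have hT := (contDiffAt_phaseTransition hq hp (phaseCoord (m := m) q γ₀ t).2).continuousAt
  have h3 := hT.tendsto.comp h2
  rw [show (extChartAt (𝓡 m) q (γ₀ t), (phaseCoord (m := m) q γ₀ t).2)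
    = phaseCoord (m := m) q γ₀ t from rfl,
    phaseTransition_phaseCoord (hγ₀.contMDiffAt t) hq hp] at h3
  refine h3.congr' ?_
  filter_upwards [h1.eventually_mem ((isOpen_extChartAt_source (I := 𝓡 m) p).mem_nhds hp),
    h1.eventually_mem ((isOpen_extChartAt_source (I := 𝓡 m) q).mem_nhds hq)] with i hip hiq
  exact phaseTransition_phaseCoord ((hγ i).contMDiffAt t) hiq hip

/-- Within one chart Grönwall bounds the phase distance at time `s` by the one at time `t`. Unit
speed curves are 1-Lipschitz, so for short times they stay in the chart. -/
lemma PhaseTendsto.all_times {ι : Type*} {l : Filter ι} {γ : ι → ℝ → M} {γ₀ : ℝ → M}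
    (hγ : ∀ i, IsUnitGeodesic m (γ i)) (hγ₀ : IsUnitGeodesic m γ₀) {t : ℝ}
    (h : PhaseTendsto (m := m) l γ γ₀ t) (s : ℝ) : PhaseTendsto (m := m) l γ γ₀ s := by
  refine forall_of_locally_constant (P := PhaseTendsto (m := m) l γ γ₀) (fun t₀ => ?_) h s
  set p := γ₀ t₀ with hp
  obtain ⟨r, hr, D, hD, K, K₂, hK, -, hf, hB, -, hdom⟩ := exists_phase_domain (m := m) p
  have hLip : LipschitzOnWith K.toNNReal (geodesicField (metricForm (m := m) p)) D := by
    refine hD.lipschitzOnWith_of_nnnorm_hasFDerivWithin_le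
      (fun x hx => (hf x hx).hasFDerivWithinAt) (fun x hx => ?_)
    rw [← NNReal.coe_le_coe, coe_nnnorm, Real.coe_toNNReal K (by linarith)]
    exact hB x hx
  refine ⟨r / 4, by positivity, fun t s ht hs hP => ?_⟩
  have hts : |t - s| < r / 2 := by
    have := abs_sub_le t t₀ s
    rw [abs_sub_comm t₀ s] at this
    linarith
  have hclose : ∀ q ∈ uIcc t s, |q - t| < r / 2 := by
    intro q hq
    have := abs_sub_left_of_mem_uIcc hq
    rw [abs_sub_comm s t] at this
    linarith
  have hnear : ∀ γ' : ℝ → M, IsUnitGeodesic m γ' → dist (γ' t) p < r / 2 → ∀ q ∈ uIcc t s,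
      dist (γ' q) p < r := by
    intro γ' hγ' hd q hq
    have h1 := hγ'.dist_le q t
    have h2 := hclose q hq
    linarith [dist_triangle (γ' q) (γ' t) p]
  have h0t : dist (γ₀ t) p < r / 2 := by
    have := hγ₀.dist_le t t₀
    linarith
  have hsmem : s ∈ uIcc t s := right_mem_uIcc
  have h0s := hdom γ₀ hγ₀ s (hnear γ₀ hγ₀ h0t s hsmem)
  have htend := hP.in_chart hγ hγ₀ (hdom γ₀ hγ₀ t (by linarith)).1
  have hev : ∀ᶠ i in l, dist (γ i t) p < r / 2 :=
    hP.1.eventually ((continuous_id.dist continuous_const).tendsto (γ₀ t) |>.eventually_lt_const h0t)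
  have hbound : ∀ᶠ i in l, ‖phaseCoord (m := m) p (γ i) s - phaseCoord p γ₀ s‖ ≤
      ‖phaseCoord (m := m) p (γ i) t - phaseCoord p γ₀ t‖
        * Real.exp (K.toNNReal * |s - t|) := by
    filter_upwards [hev] with i hi
    exact norm_sub_le_exp_of_ode hLip
      (fun q hq => (hdom (γ i) (hγ i) q (hnear _ (hγ i) hi q hq)).2)
      (fun q hq => (hdom γ₀ hγ₀ q (hnear _ hγ₀ h0t q hq)).2)
  have htends : Tendsto (fun i => phaseCoord (m := m) p (γ i) s) l (𝓝 (phaseCoord p γ₀ s)) := by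
    rw [tendsto_iff_norm_sub_tendsto_zero] at htend ⊢
    refine squeeze_zero' (Eventually.of_forall fun _ => norm_nonneg _) hbound ?_
    simpa using htend.mul_const (Real.exp (K.toNNReal * |s - t|))
  refine ⟨?_, p, h0s.1, htends⟩
  have hsymm : ContinuousAt (extChartAt (𝓡 m) p).symm (extChartAt (𝓡 m) p (γ₀ s)) :=
    continuousAt_extChartAt_symm' h0s.1
  have h4 := hsymm.tendsto.comp ((continuous_fst.tendsto _).comp htends)
  rw [(extChartAt (𝓡 m) p).left_inv h0s.1] at h4
  refine h4.congr' ?_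
  filter_upwards [hev] with i hi
  exact (extChartAt (𝓡 m) p).left_inv (hdom (γ i) (hγ i) s (hnear _ (hγ i) hi s hsmem)).1

/-- Two unit speed geodesics with the same position and velocity at one time coincide. -/
lemma IsUnitGeodesic.eq_of_phaseCoord_eq {γ γ₀ : ℝ → M} (hγ : IsUnitGeodesic m γ)
    (hγ₀ : IsUnitGeodesic m γ₀) {t : ℝ} {p : M} (hpos : γ t = γ₀ t)
    (hp : γ₀ t ∈ (extChartAt (𝓡 m) p).source)
    (h : phaseCoord (m := m) p γ t = phaseCoord p γ₀ t) : γ = γ₀ := by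
  funext s
  -- Uniqueness as continuous dependence for a constant one-element family.
  have h1 : PhaseTendsto (m := m) (pure ()) (fun _ => γ) γ₀ t :=
    ⟨hpos ▸ tendsto_const_nhds, p, hp, h ▸ tendsto_const_nhds⟩
  exact tendsto_nhds_unique tendsto_const_nhds (h1.all_times (fun _ => hγ) hγ₀ s).1

/-- The phase space coordinates of a family of curves depend strictly differentiably on the
parameter, and control the variation of `N`. -/
def PhaseStrictDiff {V W : Type*} [NormedAddCommGroup V] [NormedSpace ℝ V] [NormedAddCommGroup W]
    (N : V → W) (γ : V → ℝ → M) (v₀ : V) (t : ℝ) : Prop :=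
  ContinuousAt (fun v => γ v t) v₀ ∧ ∃ p : M, γ v₀ t ∈ (extChartAt (𝓡 m) p).source ∧
    (∃ A, HasStrictFDerivAt (𝕜 := ℝ) (fun v => phaseCoord (m := m) p (γ v) t) A v₀) ∧
    ∃ C : ℝ, 0 ≤ C ∧ ∀ᶠ q : V × V in 𝓝 (v₀, v₀), ‖N q.1 - N q.2‖ ≤
      C * ‖phaseCoord (m := m) p (γ q.1) t - phaseCoord (m := m) p (γ q.2) t‖

section StrictDiff

variable {V W : Type*} [NormedAddCommGroup V] [NormedSpace ℝ V] [NormedAddCommGroup W]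
  {N : V → W} {γ : V → ℝ → M} {v₀ : V} {t : ℝ}

-- Phase transition maps are `C^1`: the one into the new chart carries the derivative over, and the
-- Lipschitz constant of the one back multiplies the control constant.
omit [IsRiemannianManifold (𝓡 m) M] [IsContMDiffRiemannianBundle (𝓡 m) ∞ (EuclideanSpace ℝ (Fin m))
      (fun x : M => TangentSpace (𝓡 m) x)] in
lemma PhaseStrictDiff.in_chart (hγ : ∀ v, IsUnitGeodesic m (γ v))
    (h : PhaseStrictDiff (m := m) N γ v₀ t) {p : M}
    (hp : γ v₀ t ∈ (extChartAt (𝓡 m) p).source) :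
    (∃ A, HasStrictFDerivAt (𝕜 := ℝ) (fun v => phaseCoord (m := m) p (γ v) t) A v₀) ∧
    ∃ C : ℝ, 0 ≤ C ∧ ∀ᶠ q : V × V in 𝓝 (v₀, v₀), ‖N q.1 - N q.2‖ ≤
      C * ‖phaseCoord (m := m) p (γ q.1) t - phaseCoord (m := m) p (γ q.2) t‖ := by
  obtain ⟨hcont, q, hq, ⟨A, hA⟩, C, hC0, hC⟩ := h
  have hevp : ∀ᶠ v in 𝓝 v₀, γ v t ∈ (extChartAt (𝓡 m) p).source :=
    hcont.eventually_mem ((isOpen_extChartAt_source (I := 𝓡 m) p).mem_nhds hp)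
  have hevq : ∀ᶠ v in 𝓝 v₀, γ v t ∈ (extChartAt (𝓡 m) q).source :=
    hcont.eventually_mem ((isOpen_extChartAt_source (I := 𝓡 m) q).mem_nhds hq)
  have hTqp := (contDiffAt_phaseTransition hq hp
    (phaseCoord (m := m) q (γ v₀) t).2).hasStrictFDerivAt (by simp)
  have hTpq := (contDiffAt_phaseTransition hp hq
    (phaseCoord (m := m) p (γ v₀) t).2).hasStrictFDerivAt (by simp)
  have hpd := (HasStrictFDerivAt.comp v₀ (f := fun v => phaseCoord (m := m) q (γ v) t) hTqp
    hA).congr_of_eventuallyEq (f₁ := fun v => phaseCoord (m := m) p (γ v) t) (by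
      filter_upwards [hevp, hevq] with v hvp hvq
      exact phaseTransition_phaseCoord ((hγ v).contMDiffAt t) hvq hvp)
  refine ⟨⟨_, hpd⟩, ?_⟩
  obtain ⟨C', S, hS, hC'⟩ := hTpq.exists_lipschitzOnWith
  have hevS : ∀ᶠ v in 𝓝 v₀, phaseCoord (m := m) p (γ v) t ∈ S :=
    hpd.continuousAt.eventually_mem hS
  refine ⟨C * C', by positivity, ?_⟩
  have hgood := hevp.and (hevq.and hevS)
  rw [nhds_prod_eq] at hC ⊢
  filter_upwards [hC, hgood.prod_mk hgood] with w hw hw'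
  obtain ⟨⟨h1p, h1q, h1S⟩, h2p, h2q, h2S⟩ := hw'
  refine hw.trans ?_
  have hl := hC'.dist_le_mul _ h1S _ h2S
  rw [phaseTransition_phaseCoord ((hγ w.1).contMDiffAt t) h1p h1q,
    phaseTransition_phaseCoord ((hγ w.2).contMDiffAt t) h2p h2q, dist_eq_norm, dist_eq_norm] at hl
  rw [mul_assoc]
  gcongr

lemma PhaseStrictDiff.all_times (hγ : ∀ v, IsUnitGeodesic m (γ v))
    (h : PhaseStrictDiff (m := m) N γ v₀ t) (s : ℝ) : PhaseStrictDiff (m := m) N γ v₀ s := by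
  refine forall_of_locally_constant (P := PhaseStrictDiff (m := m) N γ v₀) (fun t₀ => ?_) h s
  set p := γ v₀ t₀ with hp
  obtain ⟨r, hr, D, hD, K, K₂, hK, hK₂, hf, hB, hB₂, hdom⟩ := exists_phase_domain (m := m) p
  have hLip : LipschitzOnWith K.toNNReal (geodesicField (metricForm (m := m) p)) D := by
    refine hD.lipschitzOnWith_of_nnnorm_hasFDerivWithin_le
      (fun x hx => (hf x hx).hasFDerivWithinAt) (fun x hx => ?_)
    rw [← NNReal.coe_le_coe, coe_nnnorm, Real.coe_toNNReal K (by linarith)]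
    exact hB x hx
  -- Two times within `1 / (4 * K)` of `t₀` satisfy the step condition `2 * K * |s - t| ≤ 1` of the
  -- flow lemma.
  refine ⟨min (r / 4) (1 / (4 * K)), by positivity, fun t s ht hs hP => ?_⟩
  have ht1 := ht.trans_le (min_le_left _ _)
  have hs1 := hs.trans_le (min_le_left _ _)
  have habs := abs_sub_le t t₀ s
  rw [abs_sub_comm t₀ s] at habs
  have hts : |t - s| < r / 2 := by linarith
  have hsmall : 2 * K * |s - t| ≤ 1 := by
    have ht2 := ht.trans_le (min_le_right _ _)
    have hs2 := hs.trans_le (min_le_right _ _)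
    rw [abs_sub_comm s t]
    have h1 : |t - s| ≤ 1 / (2 * K) := by
      have : 1 / (2 * K) = 1 / (4 * K) + 1 / (4 * K) := by field_simp; norm_num
      linarith
    calc 2 * K * |t - s| ≤ 2 * K * (1 / (2 * K)) := by gcongr
      _ = 1 := by field_simp
  have hclose : ∀ q ∈ uIcc t s, |q - t| < r / 2 := by
    intro q hq
    have := abs_sub_left_of_mem_uIcc hq
    rw [abs_sub_comm s t] at this
    linarith
  have hnear : ∀ γ' : ℝ → M, IsUnitGeodesic m γ' → dist (γ' t) p < r / 2 → ∀ q ∈ uIcc t s,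
      dist (γ' q) p < r := by
    intro γ' hγ' hd q hq
    have h1 := hγ'.dist_le q t
    have h2 := hclose q hq
    linarith [dist_triangle (γ' q) (γ' t) p]
  have h0t : dist (γ v₀ t) p < r / 2 := by
    have := (hγ v₀).dist_le t t₀
    linarith
  have hsmem : s ∈ uIcc t s := right_mem_uIcc
  have h0s := hdom (γ v₀) (hγ v₀) s (hnear _ (hγ v₀) h0t s hsmem)
  obtain ⟨⟨A, hA⟩, C, hC0, hC⟩ := hP.in_chart hγ (hdom (γ v₀) (hγ v₀) t (by linarith)).1
  have hev : ∀ᶠ v in 𝓝 v₀, dist (γ v t) p < r / 2 :=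
    hP.1.eventually ((continuous_id.dist continuous_const).tendsto (γ v₀ t)
      |>.eventually_lt_const h0t)
  have hode : ∀ᶠ v in 𝓝 v₀, ∀ q ∈ uIcc t s, HasDerivAt (phaseCoord (m := m) p (γ v))
      (geodesicField (metricForm p) (phaseCoord p (γ v) q)) q ∧ phaseCoord p (γ v) q ∈ D := by
    filter_upwards [hev] with v hv q hq
    exact (hdom (γ v) (hγ v) q (hnear _ (hγ v) hv q hq)).2
  obtain ⟨A', hA'⟩ := HasStrictFDerivAt.exists_ode_flow (z := fun v => phaseCoord (m := m) p (γ v))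
    hD hK hK₂ hf hB hB₂ hsmall hode hA
  refine ⟨?_, p, h0s.1, ⟨A', hA'⟩, C * Real.exp (K.toNNReal * |t - s|), by positivity, ?_⟩
  · have hsymm : ContinuousAt (extChartAt (𝓡 m) p).symm (extChartAt (𝓡 m) p (γ v₀ s)) :=
      continuousAt_extChartAt_symm' h0s.1
    have h4 := hsymm.tendsto.comp ((continuous_fst.tendsto _).comp hA'.continuousAt.tendsto)
    rw [(extChartAt (𝓡 m) p).left_inv h0s.1] at h4
    refine h4.congr' ?_
    filter_upwards [hev] with v hv
    exact (extChartAt (𝓡 m) p).left_inv (hdom (γ v) (hγ v) s (hnear _ (hγ v) hv s hsmem)).1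
  · rw [nhds_prod_eq] at hC ⊢
    filter_upwards [hC, hode.prod_mk hode] with w hw hw'
    refine hw.trans ?_
    -- Grönwall from `s` back to `t`: the later phase point controls the earlier one, hence also
    -- `N`.
    have := norm_sub_le_exp_of_ode hLip (t := s) (s := t) (x := phaseCoord (m := m) p (γ w.1))
      (y := phaseCoord (m := m) p (γ w.2)) (by rw [uIcc_comm]; exact hw'.1)
      (by rw [uIcc_comm]; exact hw'.2)
    rw [mul_assoc, mul_comm (Real.exp _)]
    gcongr

end StrictDiff

end GeodesicPropagation

/-! ### Surjectivity of maps between unit spheres. -/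

noncomputable section NormPreservingMaps

variable {E : Type*} [NormedAddCommGroup E] [NormedSpace ℝ E]

lemma contDiffAt_sqrt_self {g : E →L[ℝ] E →L[ℝ] ℝ} {a : E} (ha : 0 < g a a) :
    ContDiffAt ℝ 1 (fun v => √(g v v)) a := by
  have h : ContDiffAt ℝ 1 (fun v => g v v) a :=
    (g.contDiff.contDiffAt.clm_apply contDiffAt_id)
  exact h.sqrt ha.ne'

/-- Along a kernel vector `h` the increment of `G` would be `o(t)`, against the lower bound `t * ‖h‖
≤ C * ‖G (v₀ + t • h) - G v₀‖`. -/
lemma injective_of_hasFDerivAt_of_antilipschitz {G : E → E} {A : E →L[ℝ] E} {v₀ : E} {C : ℝ}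
    (hG : HasFDerivAt G A v₀) (hC0 : 0 ≤ C) (hC : ∀ᶠ v in 𝓝 v₀, ‖v - v₀‖ ≤ C * ‖G v - G v₀‖) :
    Function.Injective A := by
  rw [injective_iff_map_eq_zero]
  intro h hh
  have hpos : 0 < 1 / (2 * (C + 1)) := by positivity
  have ho := (hasFDerivAt_iff_isLittleO.1 hG).def hpos
  have hev : ∀ᶠ v in 𝓝 v₀, ‖v - v₀‖ ≤ 2 * C * ‖A (v - v₀)‖ := by
    filter_upwards [ho, hC] with v h1 h2
    have h3 : ‖G v - G v₀‖ ≤ ‖A (v - v₀)‖ + 1 / (2 * (C + 1)) * ‖v - v₀‖ := by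
      calc ‖G v - G v₀‖ = ‖A (v - v₀) + (G v - G v₀ - A (v - v₀))‖ := by congr 1; abel
        _ ≤ _ := (norm_add_le _ _).trans (by gcongr)
    have h4 : C * (1 / (2 * (C + 1)) * ‖v - v₀‖) ≤ 1 / 2 * ‖v - v₀‖ := by
      have : C * (1 / (2 * (C + 1))) ≤ 1 / 2 := by
        rw [mul_one_div, div_le_div_iff₀ (by positivity) (by norm_num)]
        linarith
      calc C * (1 / (2 * (C + 1)) * ‖v - v₀‖) = C * (1 / (2 * (C + 1))) * ‖v - v₀‖ := by ring
        _ ≤ _ := by gcongr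
    nlinarith [mul_le_mul_of_nonneg_left h3 hC0]
  have hline : Tendsto (fun t : ℝ => v₀ + t • h) (𝓝[>] 0) (𝓝 v₀) := by
    have : Continuous (fun t : ℝ => v₀ + t • h) := by fun_prop
    have := (this.tendsto 0).mono_left (nhdsWithin_le_nhds (s := Ioi 0))
    simpa using this
  obtain ⟨t, ht, htpos⟩ := ((hline.eventually hev).and self_mem_nhdsWithin).exists
  simp only [add_sub_cancel_left, map_smul, hh, smul_zero, norm_zero, mul_zero] at ht
  have h0 : t • h = 0 := norm_le_zero_iff.1 ht
  exact (smul_eq_zero.1 h0).resolve_left (ne_of_gt htpos)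

variable [FiniteDimensional ℝ E]

lemma image_mem_nhds_of_hasStrictFDerivAt_injective {G : E → E} {A : E →L[ℝ] E} {v₀ : E}
    (hG : HasStrictFDerivAt G A v₀) (hA : Function.Injective A) {S : Set E} (hS : S ∈ 𝓝 v₀) :
    G '' S ∈ 𝓝 (G v₀) := by
  let e : E ≃L[ℝ] E :=
    (LinearEquiv.ofInjectiveEndo (A : E →ₗ[ℝ] E) hA).toContinuousLinearEquiv
  have he : (e : E →L[ℝ] E) = A := by
    ext v
    rfl
  have := complete_of_proper (α := E)
  rw [← he] at hG
  rw [← hG.map_nhds_eq_of_equiv]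
  exact image_mem_map hS

/-- A local diffeomorphism of the complement of the origin that intertwines two inner products is
surjective in dimension at least two. -/
lemma exists_eq_of_local_diffeo_of_norm_preserving {g₁ g₂ : E →L[ℝ] E →L[ℝ] ℝ}
    (hg₁ : ∀ v ≠ 0, 0 < g₁ v v) (hg₂ : ∀ v ≠ 0, 0 < g₂ v v) {G : E → E}
    (hnorm : ∀ v ≠ 0, g₂ (G v) (G v) = g₁ v v)
    (hG : ∀ v ≠ 0, ∃ A : E →L[ℝ] E, HasStrictFDerivAt G A v ∧ Function.Injective A)
    (hrank : 1 < Module.finrank ℝ E) {w : E} (hw : w ≠ 0) : ∃ v ≠ 0, G v = w := by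
  have hS : IsOpen ({0}ᶜ : Set E) := isOpen_compl_singleton
  have hopen : IsOpen (G '' {0}ᶜ) := by
    rw [isOpen_iff_mem_nhds]
    rintro _ ⟨v, hv, rfl⟩
    obtain ⟨A, hA, hinj⟩ := hG v hv
    exact image_mem_nhds_of_hasStrictFDerivAt_injective hA hinj (hS.mem_nhds hv)
  have hconn : IsPreconnected ({0}ᶜ : Set E) := by
    refine (isConnected_compl_singleton_of_one_lt_rank ?_ 0).isPreconnected
    rw [← Module.finrank_eq_rank]
    exact_mod_cast hrank
  have hne : (({0}ᶜ : Set E) ∩ G '' {0}ᶜ).Nonempty := by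
    refine ⟨G w, ?_, w, hw, rfl⟩
    intro h0
    have := hnorm w hw
    rw [mem_singleton_iff.1 h0] at this
    simp only [map_zero] at this
    exact (hg₁ w hw).ne this
  have hc₁ : Continuous (fun v => g₁ v v) := by fun_prop
  have hc₂ : Continuous (fun v => g₂ v v) := by fun_prop
  -- The image is closed in the punctured space: by `hnorm`, values near `w` come from the compact
  -- annulus `K`, which avoids the origin.
  have hclosed : closure (G '' {0}ᶜ) ∩ {0}ᶜ ⊆ G '' {0}ᶜ := by
    rintro w ⟨hwc, hw0⟩
    have hb : 0 < g₂ w w := hg₂ w hw0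
    set b := g₂ w w with hbdef
    set K : Set E := {v | b / 2 ≤ g₁ v v ∧ g₁ v v ≤ 2 * b} with hK
    have hK0 : ∀ v ∈ K, v ≠ 0 := by
      rintro v hv rfl
      have := hv.1
      simp only [map_zero] at this
      linarith
    obtain ⟨c, hc, hcoer⟩ := exists_coercive_of_pos (g := fun _ : E => g₁)
      (isCompact_singleton (x := (0 : E))) continuousOn_const (fun _ _ a ha => hg₁ a ha)
    have hKc : IsCompact K := by
      have hKcl : IsClosed K :=
        (isClosed_le continuous_const hc₁).inter (isClosed_le hc₁ continuous_const)
      refine Metric.isCompact_of_isClosed_isBounded hKcl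
        ((Metric.isBounded_closedBall (x := (0 : E)) (r := √(2 * b / c))).subset fun v hv => ?_)
      rw [mem_closedBall_zero_iff]
      refine Real.le_sqrt_of_sq_le ?_
      rw [le_div_iff₀ hc]
      linarith [hcoer 0 rfl v, hv.2]
    have hGK : IsCompact (G '' K) := hKc.image_of_continuousOn fun v hv => by
      obtain ⟨A, hA, -⟩ := hG v (hK0 v hv)
      exact hA.hasFDerivAt.continuousAt.continuousWithinAt
    have hO : {u | b / 2 < g₂ u u ∧ g₂ u u < 2 * b} ∈ 𝓝 w :=
      ((isOpen_lt continuous_const hc₂).inter (isOpen_lt hc₂ continuous_const)).mem_nhds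
        ⟨show b / 2 < b by linarith, show b < 2 * b by linarith⟩
    have hwK : w ∈ closure (G '' K) := by
      refine mem_closure_iff_nhds.2 fun t ht => ?_
      obtain ⟨_, ⟨hut, hu1, hu2⟩, v, hv, rfl⟩ := mem_closure_iff_nhds.1 hwc _ (inter_mem ht hO)
      rw [hnorm v hv] at hu1 hu2
      exact ⟨G v, hut, v, ⟨hu1.le, hu2.le⟩, rfl⟩
    rw [hGK.isClosed.closure_eq] at hwK
    obtain ⟨v, hv, rfl⟩ := hwK
    exact ⟨v, hK0 v hv, rfl⟩
  have hsub := hconn.subset_of_closure_inter_subset hopen hne hclosed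
  obtain ⟨v, hv, hvw⟩ := hsub hw
  exact ⟨v, hv, hvw⟩

/-- A family of `g₂`-unit vectors that depends strictly differentiably on the nonzero vectors and
controls their `g₁`-directions takes all `g₂`-unit vectors as values. -/
lemma exists_eq_of_unit_of_direction_controlled {g₁ g₂ : E →L[ℝ] E →L[ℝ] ℝ}
    (hg₁ : ∀ v ≠ 0, 0 < g₁ v v) (hg₂ : ∀ v ≠ 0, 0 < g₂ v v) {W : E → E}
    (hunit : ∀ v ≠ 0, g₂ (W v) (W v) = 1) (hneg : ∀ v ≠ 0, W v ≠ W (-v))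
    (hdiff : ∀ v ≠ 0, ∃ A : E →L[ℝ] E, HasStrictFDerivAt W A v)
    (hcontrol : ∀ v₀ ≠ 0, ∃ C : ℝ, 0 ≤ C ∧ ∀ᶠ q : E × E in 𝓝 (v₀, v₀),
      ‖(√(g₁ q.1 q.1))⁻¹ • q.1 - (√(g₁ q.2 q.2))⁻¹ • q.2‖ ≤ C * ‖W q.1 - W q.2‖)
    {w : E} (hw : g₂ w w = 1) : ∃ v ≠ 0, W v = w := by
  have hw0 : w ≠ 0 := by
    rintro rfl
    simp at hw
  rcases lt_or_ge 1 (Module.finrank ℝ E) with hrank | hrank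
  · have hρpos : ∀ v ≠ 0, 0 < √(g₁ v v) := fun v hv => Real.sqrt_pos.2 (hg₁ v hv)
    have hnorm : ∀ v ≠ 0, g₂ (√(g₁ v v) • W v) (√(g₁ v v) • W v) = g₁ v v := fun v hv => by
      simp only [map_smul, smul_apply, smul_eq_mul, hunit v hv, mul_one]
      exact Real.mul_self_sqrt (hg₁ v hv).le
    -- Rescaling `W v` by the `g₁`-length of `v` turns a map of spheres into a norm preserving map
    -- of punctured spaces. Its differential is injective since `G v` determines both the direction
    -- (through `hcontrol`) and the length of `v`.
    have hloc : ∀ v ≠ 0, ∃ A : E →L[ℝ] E,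
        HasStrictFDerivAt (fun v => √(g₁ v v) • W v) A v ∧ Function.Injective A := by
      intro v₀ hv₀
      obtain ⟨A, hA⟩ := hdiff v₀ hv₀
      have hρ := (contDiffAt_sqrt_self (hg₁ v₀ hv₀)).hasStrictFDerivAt (by simp)
      have hG : HasStrictFDerivAt (fun v => √(g₁ v v) • W v) _ v₀ := hρ.smul hA
      refine ⟨_, hG, ?_⟩
      obtain ⟨C, hC0, hC⟩ := hcontrol v₀ hv₀
      have hpos₂ : 0 < g₂ (√(g₁ v₀ v₀) • W v₀) (√(g₁ v₀ v₀) • W v₀) := by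
        rw [hnorm v₀ hv₀]
        exact hg₁ v₀ hv₀
      -- As `√(g₂ (G v) (G v))` equals `ρ`, this Lipschitz bound yields `|ρ - ρ₀| ≤ K * ‖G v - G
      -- v₀‖`.
      obtain ⟨K, T, hT, hK⟩ := (contDiffAt_sqrt_self hpos₂).exists_lipschitzOnWith
      have hpair : Tendsto (fun v : E => (v, v₀)) (𝓝 v₀) (𝓝 (v₀, v₀)) :=
        (Continuous.prodMk_left v₀).tendsto v₀
      refine injective_of_hasFDerivAt_of_antilipschitz (v₀ := v₀)
        (C := C * (1 + K * ‖W v₀‖) + K * ‖(√(g₁ v₀ v₀))⁻¹ • v₀‖) hG.hasFDerivAt (by positivity) ?_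
      filter_upwards [hpair.eventually hC, hG.hasFDerivAt.continuousAt.preimage_mem_nhds hT,
        isOpen_compl_singleton.mem_nhds hv₀] with v hCv hvT hv
      have hLip := hK.dist_le_mul _ hvT _ (mem_of_mem_nhds hT)
      simp only [dist_eq_norm, hnorm v hv, hnorm v₀ hv₀] at hLip
      set ρ := √(g₁ v v)
      set ρ₀ := √(g₁ v₀ v₀)
      have hρ1 : 0 < ρ := hρpos v hv
      have hρ0 : 0 < ρ₀ := hρpos v₀ hv₀
      set δ := ‖ρ • W v - ρ₀ • W v₀‖
      have h1 : ρ * ‖W v - W v₀‖ ≤ δ + K * δ * ‖W v₀‖ := by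
        have e : ρ • (W v - W v₀) = (ρ • W v - ρ₀ • W v₀) - (ρ - ρ₀) • W v₀ := by module
        calc ρ * ‖W v - W v₀‖ = ‖ρ • (W v - W v₀)‖ := by
              rw [norm_smul, Real.norm_of_nonneg hρ1.le]
          _ ≤ δ + ‖ρ - ρ₀‖ * ‖W v₀‖ := by
              rw [e, ← norm_smul]
              exact norm_sub_le _ _
          _ ≤ _ := by gcongr
      have h2 : v - v₀ = ρ • (ρ⁻¹ • v - ρ₀⁻¹ • v₀) + (ρ - ρ₀) • (ρ₀⁻¹ • v₀) := by
        rw [smul_sub, sub_smul, smul_inv_smul₀ hρ1.ne', smul_inv_smul₀ hρ0.ne']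
        abel
      calc ‖v - v₀‖ ≤ ρ * ‖ρ⁻¹ • v - ρ₀⁻¹ • v₀‖ + ‖ρ - ρ₀‖ * ‖ρ₀⁻¹ • v₀‖ := by
            rw [h2]
            refine (norm_add_le _ _).trans_eq ?_
            rw [norm_smul, norm_smul (ρ - ρ₀), Real.norm_of_nonneg hρ1.le]
        _ ≤ ρ * (C * ‖W v - W v₀‖) + K * δ * ‖ρ₀⁻¹ • v₀‖ := by gcongr
        _ = C * (ρ * ‖W v - W v₀‖) + K * δ * ‖ρ₀⁻¹ • v₀‖ := by ring
        _ ≤ C * (δ + K * δ * ‖W v₀‖) + K * δ * ‖ρ₀⁻¹ • v₀‖ := by gcongr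
        _ = _ := by ring
    obtain ⟨v, hv, hvw⟩ := exists_eq_of_local_diffeo_of_norm_preserving hg₁ hg₂ hnorm hloc hrank hw0
    refine ⟨v, hv, ?_⟩
    have h1 := hnorm v hv
    rw [hvw, hw] at h1
    rwa [← h1, Real.sqrt_one, one_smul] at hvw
  -- In dimension one the only unit vectors are `w` and `-w`; `hneg` makes `W` take both values.
  · have hline : ∀ u, g₂ u u = 1 → u = w ∨ u = -w := by
      intro u hu
      have hrank1 : Module.finrank ℝ E = 1 :=
        hrank.antisymm (Module.finrank_pos_iff_exists_ne_zero.2 ⟨w, hw0⟩)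
      obtain ⟨a, rfl⟩ := (finrank_eq_one_iff_of_nonzero' w hw0).1 hrank1 u
      simp only [map_smul, smul_apply, smul_eq_mul, hw, mul_one] at hu
      rcases mul_self_eq_one_iff.1 hu with rfl | rfl
      · simp
      · simp
    have hw0' : -w ≠ 0 := neg_ne_zero.2 hw0
    rcases hline _ (hunit w hw0) with h | h
    · exact ⟨w, hw0, h⟩
    · refine ⟨-w, hw0', (hline _ (hunit _ hw0')).resolve_right fun h' => ?_⟩
      exact hneg w hw0 (h.trans h'.symm)

end NormPreservingMaps

/-! ### Approximate focusing, its limit, and the way back from `x`. -/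

noncomputable section Focusing

variable {m : ℕ} {M : Type*} [MetricSpace M] [ChartedSpace (EuclideanSpace ℝ (Fin m)) M]

local notation "𝔼" => EuclideanSpace ℝ (Fin m)

lemma phaseCoord_comp_neg (p : M) (γ : ℝ → M) (t : ℝ) :
    phaseCoord (m := m) p (fun s => γ (-s)) t =
      ((phaseCoord (m := m) p γ (-t)).1, -(phaseCoord (m := m) p γ (-t)).2) :=
  Prod.ext rfl (deriv_comp_neg (fun s => extChartAt (𝓡 m) p (γ s)) t)

lemma phaseCoord_comp_add_const (p : M) (γ : ℝ → M) (a t : ℝ) :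
    phaseCoord (m := m) p (fun s => γ (s + a)) t = phaseCoord (m := m) p γ (t + a) :=
  Prod.ext rfl (deriv_comp_add_const (fun s => extChartAt (𝓡 m) p (γ s)) a t)

variable [RiemannianBundle (fun x : M => TangentSpace (𝓡 m) x)] [IsManifold (𝓡 m) ∞ M]

lemma IsUnitGeodesic.metricForm_phaseCoord {γ : ℝ → M} (hγ : IsUnitGeodesic m γ) {p : M} {t : ℝ}
    (ht : γ t ∈ (extChartAt (𝓡 m) p).source) :
    metricForm (m := m) p (extChartAt (𝓡 m) p (γ t)) (phaseCoord p γ t).2 (phaseCoord p γ t).2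
      = 1 := by
  have h := norm_sq_velocity (hγ.1.mdifferentiableAt t) ht
  rw [hγ.2 t, one_pow] at h
  exact h.symm

lemma IsUnitGeodesic.comp_neg {γ : ℝ → M} (hγ : IsUnitGeodesic m γ) :
    IsUnitGeodesic m (fun t => γ (-t)) := by
  refine ⟨hγ.1.comp_neg, fun t => ?_⟩
  have h := norm_sq_velocity (hγ.1.comp_neg.mdifferentiableAt t) (mem_extChartAt_source (γ (-t)))
  rw [phaseCoord_comp_neg] at h
  simp only [map_neg, neg_apply, neg_neg] at h
  rw [← norm_sq_velocity (hγ.1.mdifferentiableAt (-t)) (mem_extChartAt_source (γ (-t))),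
    hγ.2 (-t)] at h
  exact (sq_eq_sq₀ (norm_nonneg _) zero_le_one).1 h

lemma IsUnitGeodesic.comp_add_const {γ : ℝ → M} (hγ : IsUnitGeodesic m γ) (a : ℝ) :
    IsUnitGeodesic m (fun t => γ (t + a)) := by
  refine ⟨hγ.1.comp_add_const a, fun t => ?_⟩
  have h := norm_sq_velocity ((hγ.1.comp_add_const a).mdifferentiableAt t)
    (mem_extChartAt_source (γ (t + a)))
  rw [phaseCoord_comp_add_const] at h
  rw [← norm_sq_velocity (hγ.1.mdifferentiableAt (t + a)) (mem_extChartAt_source (γ (t + a))),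
    hγ.2 (t + a)] at h
  exact (sq_eq_sq₀ (norm_nonneg _) zero_le_one).1 h

variable [IsContMDiffRiemannianBundle (𝓡 m) ∞ (EuclideanSpace ℝ (Fin m))
      (fun x : M => TangentSpace (𝓡 m) x)]

lemma IsGeodesic.isUnitGeodesic {γ : ℝ → M} (hγ : IsGeodesic m γ) {t : ℝ}
    (h : ‖velocity m γ t‖ = 1) : IsUnitGeodesic m γ :=
  ⟨hγ, fun s => (hγ.norm_velocity_eq s t).trans h⟩

/-- In a complete manifold there is a unit speed geodesic in every direction. -/
lemma IsGeodesicallyComplete.exists_isUnitGeodesic (hcomplete : IsGeodesicallyComplete m M)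
    {p q : M} (hq : q ∈ (extChartAt (𝓡 m) p).source) {a : 𝔼} (ha : a ≠ 0) :
    ∃ γ : ℝ → M, IsUnitGeodesic m γ ∧ γ 0 = q ∧ phaseCoord p γ 0 = (extChartAt (𝓡 m) p q,
      (√(metricForm (m := m) p (extChartAt (𝓡 m) p q) a a))⁻¹ • a) := by
  have htar := (extChartAt (𝓡 m) p).map_source hq
  have hpos := metricForm_pos (m := m) p htar ha
  set b : 𝔼 := (√(metricForm (m := m) p (extChartAt (𝓡 m) p q) a a))⁻¹ • a with hb
  have hunit : metricForm (m := m) p (extChartAt (𝓡 m) p q) b b = 1 := by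
    have hs := Real.mul_self_sqrt hpos.le
    simp only [hb, map_smul, smul_apply, smul_eq_mul]
    rw [← mul_assoc, ← mul_inv, hs, inv_mul_cancel₀ hpos.ne']
  obtain ⟨γ, hγ, hγ0⟩ := hcomplete (tangentOfCoord p (extChartAt (𝓡 m) p q, b))
  have hpt : γ 0 = q :=
    (congrArg TotalSpace.proj hγ0).trans ((extChartAt (𝓡 m) p).left_inv hq)
  have hsrc : γ 0 ∈ (extChartAt (𝓡 m) p).source := hpt ▸ hq
  have hmd := hγ.mdifferentiableAt 0
  have hphase : phaseCoord (m := m) p γ 0 = (extChartAt (𝓡 m) p q, b) :=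
    tangentOfCoord_injOn p ⟨(extChartAt (𝓡 m) p).map_source hsrc, mem_univ _⟩
      ⟨htar, mem_univ _⟩ ((tangentOfCoord_phaseCoord hmd hsrc).symm.trans hγ0)
  refine ⟨γ, hγ.isUnitGeodesic (t := 0) ?_, hpt, hphase⟩
  have h := norm_sq_velocity hmd hsrc
  rw [hphase, hunit] at h
  exact (sq_eq_sq₀ (norm_nonneg _) zero_le_one).1 (h.trans (one_pow 2).symm)

lemma IsGeodesicallyComplete.exists_isUnitGeodesic_from (hcomplete : IsGeodesicallyComplete m M)
    (hm : 1 ≤ m) (y : M) : ∃ γ : ℝ → M, IsUnitGeodesic m γ ∧ γ 0 = y := by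
  have : Nonempty (Fin m) := ⟨⟨0, hm⟩⟩
  obtain ⟨a, ha⟩ := exists_ne (0 : 𝔼)
  obtain ⟨γ, hγ, h0, -⟩ := hcomplete.exists_isUnitGeodesic (mem_extChartAt_source (I := 𝓡 m) y) ha
  exact ⟨γ, hγ, h0⟩

variable [IsRiemannianManifold (𝓡 m) M]

/-- Focusing times larger than the focusing radii do not tend to zero. -/
lemma FocusesWithin.lim_time_ne_zero (hcomplete : IsGeodesicallyComplete m M) (hm : 1 ≤ m) {x : M}
    {ε l : ℕ → ℝ} {y : ℕ → M} (hε_lim : Tendsto ε atTop (𝓝 0)) (hl : ∀ n, ε n < l n)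
    (hfocus : ∀ n, FocusesWithin m (y n) (l n) (ε n) x) {llim : ℝ}
    (hlim : Tendsto l atTop (𝓝 llim)) : llim ≠ 0 := by
  rintro rfl
  obtain ⟨r, hr, hmin⟩ := exists_forall_le_dist_of_isUnitGeodesic (m := m) x
  obtain ⟨n, hεn, hln⟩ := ((hε_lim.eventually_lt_const hr).and
    (hlim.eventually_lt_const (half_pos hr))).exists
  obtain ⟨γ, hγ, h0⟩ := hcomplete.exists_isUnitGeodesic_from hm (y n)
  have h1 := hfocus n γ hγ.1 hγ.2 h0
  have h2 : dist (γ (-l n)) x < ε n :=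
    hfocus n _ hγ.comp_neg.1 hγ.comp_neg.2 (by simpa using h0)
  have h3 := hl n
  have hpos : 0 < l n := (dist_nonneg.trans_lt h1).trans h3
  -- The segment has length `2 * l n`, yet its ends are less than `2 * ε n < 2 * l n` apart.
  have h4 := hmin γ hγ (-l n) (l n) (h2.trans hεn) (by linarith) (by linarith)
  have h5 := dist_triangle_right (γ (-l n)) (γ (l n)) x
  linarith

/-- In the limit all geodesics focus at `x`. -/
lemma FocusesWithin.lim_eq (hcomplete : IsGeodesicallyComplete m M) (hm : 1 ≤ m) {x : M}
    {ε l : ℕ → ℝ} {y : ℕ → M} (hε_lim : Tendsto ε atTop (𝓝 0))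
    (hfocus : ∀ n, FocusesWithin m (y n) (l n) (ε n) x) {ylim : M} {llim : ℝ}
    (hy : Tendsto y atTop (𝓝 ylim)) (hlim : Tendsto l atTop (𝓝 llim)) {γ : ℝ → M}
    (hγ : IsUnitGeodesic m γ) (h0 : γ 0 = ylim) : γ llim = x := by
  have hsrc : γ 0 ∈ (extChartAt (𝓡 m) ylim).source := h0 ▸ mem_extChartAt_source _
  have hunit := hγ.metricForm_phaseCoord hsrc
  rw [h0] at hunit
  set a := (phaseCoord (m := m) ylim γ 0).2 with ha
  have ha0 : a ≠ 0 := by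
    intro h
    rw [h] at hunit
    simp only [map_zero] at hunit
    exact zero_ne_one hunit
  -- Geodesics from `y n` with the coordinate direction of `γ`, renormalised at `y n`. Outside the
  -- chart any geodesic will do, since `y n` is eventually inside.
  have hex : ∀ n, ∃ γ' : ℝ → M, IsUnitGeodesic m γ' ∧ γ' 0 = y n ∧
      (y n ∈ (extChartAt (𝓡 m) ylim).source → phaseCoord ylim γ' 0 =
        (extChartAt (𝓡 m) ylim (y n),
          (√(metricForm (m := m) ylim (extChartAt (𝓡 m) ylim (y n)) a a))⁻¹ • a)) := by
    intro n
    by_cases hn : y n ∈ (extChartAt (𝓡 m) ylim).source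
    · obtain ⟨γ', h1, h2, h3⟩ := hcomplete.exists_isUnitGeodesic hn ha0
      exact ⟨γ', h1, h2, fun _ => h3⟩
    · obtain ⟨γ', h1, h2⟩ := hcomplete.exists_isUnitGeodesic_from hm (y n)
      exact ⟨γ', h1, h2, fun h => absurd h hn⟩
  choose Γ hΓ hΓ0 hΓphase using hex
  have hcoord : Tendsto (fun n => extChartAt (𝓡 m) ylim (y n)) atTop
      (𝓝 (extChartAt (𝓡 m) ylim ylim)) :=
    (continuousAt_extChartAt (I := 𝓡 m) ylim).tendsto.comp hy
  have hmetric : Tendsto (fun n => metricForm (m := m) ylim (extChartAt (𝓡 m) ylim (y n)) a a)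
      atTop (𝓝 1) := by
    have h1 := (differentiableAt_metricForm ylim (mem_extChartAt_target (I := 𝓡 m)
      ylim)).continuousAt.tendsto.comp hcoord
    have h2 : Continuous (fun g : 𝔼 →L[ℝ] 𝔼 →L[ℝ] ℝ => g a a) := by fun_prop
    have h3 := (h2.tendsto _).comp h1
    rwa [hunit] at h3
  have hphase : PhaseTendsto (m := m) atTop Γ γ 0 := by
    refine ⟨by simpa only [hΓ0, h0] using hy, ylim, hsrc, ?_⟩
    have hlimit : Tendsto (fun n => (extChartAt (𝓡 m) ylim (y n),
        (√(metricForm (m := m) ylim (extChartAt (𝓡 m) ylim (y n)) a a))⁻¹ • a)) atTop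
        (𝓝 (phaseCoord (m := m) ylim γ 0)) := by
      have e : phaseCoord (m := m) ylim γ 0 = (extChartAt (𝓡 m) ylim ylim, a) :=
        Prod.ext (by rw [← h0]; rfl) rfl
      rw [e]
      refine hcoord.prodMk_nhds ?_
      have h := ((hmetric.sqrt).inv₀ (by simp)).smul_const a
      simpa using h
    refine hlimit.congr' ?_
    filter_upwards [hy.eventually_mem (extChartAt_source_mem_nhds (I := 𝓡 m) ylim)] with n hn
    exact (hΓphase n hn).symm
  have hlimit := (hphase.all_times hΓ hγ llim).1
  refine tendsto_nhds_unique hlimit (tendsto_iff_dist_tendsto_zero.2 ?_)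
  refine squeeze_zero (fun _ => dist_nonneg) (g := fun n => |llim - l n| + ε n) (fun n => ?_) ?_
  · refine (dist_triangle _ (Γ n (l n)) _).trans (add_le_add ((hΓ n).dist_le _ _) ?_)
    exact (hfocus n (Γ n) (hΓ n).1 (hΓ n).2 (hΓ0 n)).le
  · have h := ((tendsto_const_nhds (x := llim)).sub hlim).abs.add hε_lim
    simpa using h

/-- If all unit speed geodesics from `y` are at `x` at time `l`, then all unit speed geodesics
from `x` are at `y` at time `-l`. -/
lemma IsUnitGeodesic.apply_neg_eq_of_forall (hcomplete : IsGeodesicallyComplete m M) (hm : 1 ≤ m)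
    {x y : M} {l : ℝ} (h : ∀ γ : ℝ → M, IsUnitGeodesic m γ → γ 0 = y → γ l = x) {γ : ℝ → M}
    (hγ : IsUnitGeodesic m γ) (h0 : γ 0 = x) : γ (-l) = y := by
  have hy : y ∈ (extChartAt (𝓡 m) y).source := mem_extChartAt_source _
  have hx : x ∈ (extChartAt (𝓡 m) x).source := mem_extChartAt_source _
  set g₁ := metricForm (m := m) y (extChartAt (𝓡 m) y y)
  set g₂ := metricForm (m := m) x (extChartAt (𝓡 m) x x)
  have hg₁ : ∀ v ≠ 0, 0 < g₁ v v := fun v hv => metricForm_pos y (mem_extChartAt_target y) hv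
  have hg₂ : ∀ v ≠ 0, 0 < g₂ v v := fun v hv => metricForm_pos x (mem_extChartAt_target x) hv
  -- Indexing by all nonzero vectors rather than unit ones keeps the calculus on an open subset of a
  -- vector space; the choice at `v = 0` is arbitrary.
  have hex : ∀ v : 𝔼, ∃ γ : ℝ → M, IsUnitGeodesic m γ ∧ γ 0 = y ∧ (v ≠ 0 →
      phaseCoord y γ 0 = (extChartAt (𝓡 m) y y, (√(g₁ v v))⁻¹ • v)) := by
    intro v
    by_cases hv : v = 0
    · obtain ⟨γ', h1, h2⟩ := hcomplete.exists_isUnitGeodesic_from hm y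
      exact ⟨γ', h1, h2, fun h => absurd hv h⟩
    · obtain ⟨γ', h1, h2, h3⟩ := hcomplete.exists_isUnitGeodesic hy hv
      exact ⟨γ', h1, h2, fun _ => h3⟩
  choose Γ hΓ hΓ0 hΓphase using hex
  have hΓl : ∀ v, Γ v l = x := fun v => h _ (hΓ v) (hΓ0 v)
  have hphase_l : ∀ v, phaseCoord (m := m) x (Γ v) l =
      (extChartAt (𝓡 m) x x, (phaseCoord (m := m) x (Γ v) l).2) := fun v =>
    Prod.ext (by rw [← hΓl v]; rfl) rfl
  -- At time `0` the controlled direction is the velocity coordinate itself, so the control constant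
  -- is `1`.
  have hstrict : ∀ v₀ ≠ 0, PhaseStrictDiff (m := m) (fun v => (√(g₁ v v))⁻¹ • v) Γ v₀ 0 := by
    intro v₀ hv₀
    have hev : ∀ᶠ v in 𝓝 v₀, v ≠ 0 := isOpen_compl_singleton.mem_nhds hv₀
    refine ⟨by simpa only [hΓ0] using continuousAt_const, y, by rwa [hΓ0], ?_, 1, zero_le_one, ?_⟩
    · have h1 := ((contDiffAt_sqrt_self (hg₁ v₀ hv₀)).inv
        (Real.sqrt_pos.2 (hg₁ v₀ hv₀)).ne').smul contDiffAt_id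
      have h2 := (contDiffAt_const (c := extChartAt (𝓡 m) y y)).prodMk h1
      refine ⟨_, (h2.hasStrictFDerivAt (by simp)).congr_of_eventuallyEq ?_⟩
      filter_upwards [hev] with v hv
      exact (hΓphase v hv).symm
    · filter_upwards [hev.prod_nhds hev] with q hq
      rw [hΓphase _ hq.1, hΓphase _ hq.2, one_mul, Prod.mk_sub_mk, sub_self,
        Prod.norm_mk, norm_zero, max_eq_right (norm_nonneg _)]
  have hstrict_l : ∀ v₀ : 𝔼, v₀ ≠ 0 → _ := fun v₀ hv₀ =>
    ((hstrict v₀ hv₀).all_times hΓ l).in_chart hΓ (p := x) (by rwa [hΓl])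
  have hinj : ∀ {γ γ' : ℝ → M}, IsUnitGeodesic m γ → IsUnitGeodesic m γ' → γ l = x → γ' l = x →
      (phaseCoord (m := m) x γ l).2 = (phaseCoord (m := m) x γ' l).2 → γ = γ' :=
    fun hγ hγ' h1 h2 h3 => hγ.eq_of_phaseCoord_eq hγ' (h1.trans h2.symm) (p := x) (by rwa [h2])
      (Prod.ext (congrArg (extChartAt (𝓡 m) x) (h1.trans h2.symm)) h3)
  have hsurj := exists_eq_of_unit_of_direction_controlled (g₁ := g₁) (g₂ := g₂) hg₁ hg₂
    (W := fun v => (phaseCoord (m := m) x (Γ v) l).2) ?_ ?_ ?_ ?_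
    (w := (phaseCoord (m := m) x γ 0).2) ?_
  · obtain ⟨v, -, hv⟩ := hsurj
    -- Shifted by `-l`, `γ` passes through `x` at time `l` with the same velocity as `Γ v`; the two
    -- coincide, and at time `0` both are at `y`.
    have hshift : phaseCoord (m := m) x (fun t => γ (t + -l)) l = phaseCoord (m := m) x γ 0 := by
      rw [phaseCoord_comp_add_const, add_neg_cancel]
    have heq := hinj (hΓ v) (hγ.comp_add_const (-l)) (hΓl v) (by simpa using h0)
      (by rw [hshift]; exact hv)
    have h2 := congrFun heq 0
    rw [hΓ0] at h2
    simpa using h2.symm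
  · intro v _
    have h1 := (hΓ v).metricForm_phaseCoord (p := x) (t := l) (by rwa [hΓl])
    rwa [hΓl] at h1
  · intro v hv heq
    have h1 := hinj (hΓ v) (hΓ (-v)) (hΓl v) (hΓl (-v)) heq
    have h2 := hΓphase v hv
    rw [h1, hΓphase (-v) (neg_ne_zero.2 hv)] at h2
    have h3 := congrArg Prod.snd h2
    simp only [map_neg, neg_apply, neg_neg, smul_neg] at h3
    -- If `Γ v = Γ (-v)`, the normalised `v` would equal its own negative.
    have h4 : (2 : ℝ) • (√(g₁ v v))⁻¹ • v = 0 := by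
      rw [two_smul, ← neg_eq_iff_add_eq_zero, h3]
    rcases smul_eq_zero.1 ((smul_eq_zero.1 h4).resolve_left two_ne_zero) with h5 | h5
    · exact inv_ne_zero (Real.sqrt_pos.2 (hg₁ v hv)).ne' h5
    · exact hv h5
  · intro v hv
    obtain ⟨⟨A, hA⟩, -⟩ := hstrict_l v hv
    exact ⟨_, hA.snd⟩
  · intro v hv
    obtain ⟨-, C, hC0, hC⟩ := hstrict_l v hv
    refine ⟨C, hC0, hC.mono fun q hq => hq.trans_eq ?_⟩
    rw [hphase_l q.1, hphase_l q.2, Prod.mk_sub_mk, sub_self, Prod.norm_mk, norm_zero,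
      max_eq_right (norm_nonneg _)]
  · have h1 := hγ.metricForm_phaseCoord (p := x) (t := 0) (by rwa [h0])
    rwa [h0] at h1

end Focusing

end

theorem mainTheorem6 (m : ℕ) (hm : 1 ≤ m) {M : Type*} [MetricSpace M] [ConnectedSpace M]
    [ChartedSpace (EuclideanSpace ℝ (Fin m)) M] [IsManifold (𝓡 m) ∞ M]
    [RiemannianBundle (fun x : M => TangentSpace (𝓡 m) x)]
    [IsContMDiffRiemannianBundle (𝓡 m) ∞ (EuclideanSpace ℝ (Fin m))
      (fun x : M => TangentSpace (𝓡 m) x)]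
    [IsRiemannianManifold (𝓡 m) M]
    (hcomplete : IsGeodesicallyComplete m M)
    (x : M) (hY : IsYTildeManifold m x)
    (ε : ℕ → ℝ) (hε_pos : ∀ n, 0 < ε n) (hε_lim : Tendsto ε atTop (𝓝 0))
    (y : ℕ → M) (l : ℕ → ℝ) (hl : ∀ n, ε n < l n)
    (hfocus : ∀ n, FocusesWithin m (y n) (l n) (ε n) x)
    (φ : ℕ → ℕ) (hφ : StrictMono φ) (ylim : M) (llim : ℝ)
    (hlim : Tendsto (fun k => (y (φ k), l (φ k))) atTop (𝓝 (ylim, llim))) :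
    llim ≠ 0 ∧ IsYlManifold m x (2 * llim) := by
  have hy : Tendsto (fun k => y (φ k)) atTop (𝓝 ylim) :=
    (continuous_fst.tendsto (ylim, llim)).comp hlim
  have hlt : Tendsto (fun k => l (φ k)) atTop (𝓝 llim) :=
    (continuous_snd.tendsto (ylim, llim)).comp hlim
  have hεt : Tendsto (fun k => ε (φ k)) atTop (𝓝 0) := hε_lim.comp hφ.tendsto_atTop
  have hne : llim ≠ 0 := FocusesWithin.lim_time_ne_zero hcomplete hm hεt (fun k => hl (φ k))
    (fun k => hfocus (φ k)) hlt
  have hto : ∀ γ : ℝ → M, IsUnitGeodesic m γ → γ 0 = ylim → γ llim = x := fun γ hγ h0 =>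
    FocusesWithin.lim_eq hcomplete hm hεt (fun k => hfocus (φ k)) hy hlt hγ h0
  refine ⟨hne, mul_ne_zero two_ne_zero hne, fun γ hγ h0 hunit => ?_⟩
  have hγu := hγ.isUnitGeodesic hunit
  have h1 : γ llim = ylim := by
    have h := IsUnitGeodesic.apply_neg_eq_of_forall hcomplete hm hto hγu.comp_neg
      (by simpa using h0)
    simpa using h
  have h2 := hto _ (hγu.comp_add_const llim) (by simpa using h1)
  rw [two_mul]
  exact h2
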